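/- Let $n \ge 0$ be an integer and write $[n] = \{0,1,\dots,n\}$. Define polynomials $I_n, F_n, B_n \in \mathbb{Z}[q,t]$ as follows. **Trees.** Let $\mathcal{T}_n$ be the set of trees with vertex set $[n]$, rooted at $0$. For distinct vertices $i,j$ of $T\in\mathcal{T}_n$, call $j$ a descendant of $i$ if $i$ lies on the path from $j$ to $0$. Let $\mathrm{inv}(T)$ (respectively $\mathrm{coinv}(T)$) be the number of pairs $(i,j)$ such that $j$ is a descendant of $i$ and $i>j$ (respectively $i<j$), and let $$I_n(q,t)=\sum_{T\in\mathcal{T}_n} q^{\mathrm{inv}(T)}\,t^{\mathrm{coinv}(T)}.$$ **Factorizations.** Let $\mathcal{F}_n$ be the set of sequences $f=\big((a_1\,b_1),\dots,(a_n\,b_n)\big)$ of $n$ transpositions of $[n]$, written with $a_k<b_k$, whose product, taken from left to right (the first factor acts first), is the cycle $(0\,1\,\cdots\,n)$. Let $\mathrm{area}_L(f)=\binom n2-\sum_k a_k$ and $\mathrm{area}_U(f)=\sum_k b_k-\binom n2$, and let $$F_n(q,t)=\sum_{f\in\mathcal{F}_n} q^{\mathrm{area}_L(f)}\,t^{\mathrm{area}_U(f)}.$$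 **Parking functions.** Let $\mathcal{P}_n$ be the set of sequences $p=(p_1,\dots,p_n)$ of nonnegative integers whose nondecreasing rearrangement $p'_1\le\dots\le p'_n$ satisfies $p'_i\le i-1$ for all $i$. For $p\in\mathcal{P}_n$ put $w_0=0$, and let $w_1,\dots,w_n$ be the arrangement of the labels $1,\dots,n$ in which $c$ precedes $d$ if $p_c<p_d$, or if $p_c=p_d$ and $c>d$. (These are the labels, from left to right, of the horizontal steps of the labelled Dyck path of $p$.) For $i=n,n-1,\dots,0$ define recursively $$C_{w_i}=\{c\in\{1,\dots,n\} : p_c=i\},\qquad D_{w_i}=C_{w_i}\cup\bigcup_{j\in C_{w_i}}D_j .$$ Let $\mathrm{pinv}(p)=\sum_{v=0}^n\#\{j\in D_v: j<v\}$ and $\mathrm{copinv}(p)=\sum_{v=0}^n\#\{j\in D_v: j>v\}$, and let $$B_n(q,t)=\sum_{p\in\mathcal{P}_n} q^{\mathrm{pinv}(p)}\,t^{\mathrm{copinv}(p)}.$$ **Theorem.** For every $n\ge 0$, the integers $\mathrm{area}_L(f)$ and $\mathrm{area}_U(f)$ are nonnegative for all $f\in\mathcal{F}_n$ (so that $F_n(q,t)$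 is indeed a polynomial), and $$I_n(q,t)=F_n(q,t)=B_n(q,t).$$ -/

import Mathlib

namespace BounceRef

/-! Throughout, `[n] = {0, 1, …, n}` is the type `Fin (n + 1)`, and a polynomial in `q, t` is an
element of `MvPolynomial (Fin 2) ℤ` with `q = X 0` and `t = X 1`. -/

/-- The indeterminate `q`. -/
noncomputable def q : MvPolynomial (Fin 2) ℤ := MvPolynomial.X 0

/-- The indeterminate `t`. -/
noncomputable def t : MvPolynomial (Fin 2) ℤ := MvPolynomial.X 1

section Trees

/-- `j` is a descendant of `i` in `T`, rooted at `0`: `i ≠ j` and `i` lies on the path from `j` to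
the root. -/
def IsDescendant {n : ℕ} (T : SimpleGraph (Fin (n + 1))) (i j : Fin (n + 1)) : Prop :=
  i ≠ j ∧ ∃ P : T.Walk j 0, P.IsPath ∧ i ∈ P.support

open Classical in
/-- The set of trees with vertex set `[n]`. -/
noncomputable def trees (n : ℕ) : Finset (SimpleGraph (Fin (n + 1))) :=
  Finset.univ.filter fun T => T.IsTree

open Classical in
/-- The number of inversions: pairs `(i, j)` with `j` a descendant of `i` and `i > j`. -/
noncomputable def inv {n : ℕ} (T : SimpleGraph (Fin (n + 1))) : ℕ :=
  (Finset.univ.filter fun x : Fin (n + 1) × Fin (n + 1) =>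
    IsDescendant T x.1 x.2 ∧ x.2 < x.1).card

open Classical in
/-- The number of coinversions: pairs `(i, j)` with `j` a descendant of `i` and `i < j`. -/
noncomputable def coinv {n : ℕ} (T : SimpleGraph (Fin (n + 1))) : ℕ :=
  (Finset.univ.filter fun x : Fin (n + 1) × Fin (n + 1) =>
    IsDescendant T x.1 x.2 ∧ x.1 < x.2).card

/-- The inversion/coinversion enumerator `I_n(q, t)` of trees. -/
noncomputable def treePoly (n : ℕ) : MvPolynomial (Fin 2) ℤ :=
  ∑ T ∈ trees n, q ^ inv T * t ^ coinv T

end Trees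

section Factorizations

/-- The product, from left to right, of the transpositions `(a₁ b₁), …, (aₙ bₙ)`, that is, the
permutation which first applies `(a₁ b₁)`, then `(a₂ b₂)`, and so on. Mathlib's product of
permutations applies the right factor first, whence the reversal. -/
def leftToRightProd {n : ℕ} (f : Fin n → Fin (n + 1) × Fin (n + 1)) :
    Equiv.Perm (Fin (n + 1)) :=
  (List.ofFn fun k => Equiv.swap (f k).1 (f k).2).reverse.prod

/-- The set of minimal factorizations of the full cycle `(0 1 ⋯ n)`: sequences of `n`
transpositions with product `(0 1 ⋯ n)`, where a transposition `(a b)` is given by the pair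
`(a, b)` with `a < b`. -/
def factorizations (n : ℕ) : Finset (Fin n → Fin (n + 1) × Fin (n + 1)) :=
  Finset.univ.filter fun f =>
    (∀ k, (f k).1 < (f k).2) ∧ leftToRightProd f = finRotate (n + 1)

/-- The lower area `n choose 2 - (a₁ + ⋯ + aₙ)`, as an integer. -/
def areaL {n : ℕ} (f : Fin n → Fin (n + 1) × Fin (n + 1)) : ℤ :=
  (n.choose 2 : ℤ) - ∑ k, ((f k).1 : ℤ)

/-- The upper area `(b₁ + ⋯ + bₙ) - n choose 2`, as an integer. -/
def areaU {n : ℕ} (f : Fin n → Fin (n + 1) × Fin (n + 1)) : ℤ :=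
  ∑ k, ((f k).2 : ℤ) - (n.choose 2 : ℤ)

/-- The enumerator `F_n(q, t)` of minimal factorizations of `(0 1 ⋯ n)` by lower and upper area. -/
noncomputable def factPoly (n : ℕ) : MvPolynomial (Fin 2) ℤ :=
  ∑ f ∈ factorizations n, q ^ (areaL f).toNat * t ^ (areaU f).toNat

end Factorizations

section ParkingFunctions

/-- A parking function of length `n`: the `i`-th entry (`i = 1, …, n`) of the nondecreasing
rearrangement is at most `i - 1`. Entries are indexed from `0` here. -/
def IsParkingFunction {n : ℕ} (p : Fin n → ℕ) : Prop :=
  ∀ i : Fin n, p (Tuple.sort p i) ≤ i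

open Classical in
/-- The set of parking functions of length `n`. -/
noncomputable def parkingFunctions (n : ℕ) : Finset (Fin n → ℕ) :=
  (Fintype.piFinset fun _ => Finset.range n).filter IsParkingFunction

/-- The bound on the entries in `parkingFunctions` is no restriction. -/
theorem mem_parkingFunctions {n : ℕ} (p : Fin n → ℕ) :
    p ∈ parkingFunctions n ↔ IsParkingFunction p := by
  classical
  simp only [parkingFunctions, Finset.mem_filter, Fintype.mem_piFinset, Finset.mem_range,
    and_iff_right_iff_imp]
  intro h i
  have := h ((Tuple.sort p).symm i)
  rw [Equiv.apply_symm_apply] at this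
  omega

/-- The word `w₀ w₁ ⋯ wₙ`: `w₀ = 0`, and `w₁, …, wₙ` are the labels `1, …, n` (the label of the
`c`-th entry, counted from `0`, being `c + 1`) on the horizontal steps of the labelled Dyck path
of `p`, read from left to right. The labels are thus sorted by height `p c`, and those at the same
height are in decreasing order. -/
def word {n : ℕ} (p : Fin n → ℕ) : Fin (n + 1) → Fin (n + 1) :=
  Fin.cases 0 fun i =>
    (Tuple.sort (fun c : Fin n => toLex (p c, OrderDual.toDual c)) i).succ

/-- `C_v`: for `v = wᵢ`, the set of labels at height `i`. -/
def C {n : ℕ} (p : Fin n → ℕ) (v : Fin (n + 1)) : Finset (Fin (n + 1)) :=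
  Finset.univ.filter fun j =>
    ∃ i : Fin (n + 1), word p i = v ∧ ∃ c : Fin n, c.succ = j ∧ p c = i

/-- Membership `j ∈ D_v`, where `D_v = C_v ∪ ⋃_{k ∈ C_v} D_k`. -/
inductive MemD {n : ℕ} (p : Fin n → ℕ) : Fin (n + 1) → Fin (n + 1) → Prop
  | base {v j : Fin (n + 1)} : j ∈ C p v → MemD p v j
  | step {v k j : Fin (n + 1)} : k ∈ C p v → MemD p k j → MemD p v j

open Classical in
/-- The set `D_v`. -/
noncomputable def D {n : ℕ} (p : Fin n → ℕ) (v : Fin (n + 1)) : Finset (Fin (n + 1)) :=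
  Finset.univ.filter fun j => MemD p v j

/-- The recursion that defines the sets `D_v`. -/
theorem D_eq {n : ℕ} (p : Fin n → ℕ) (v : Fin (n + 1)) :
    D p v = C p v ∪ (C p v).biUnion (D p) := by
  classical
  ext j
  simp only [D, Finset.mem_filter, Finset.mem_univ, true_and, Finset.mem_union,
    Finset.mem_biUnion]
  constructor
  · rintro (h | ⟨hk, h⟩)
    · exact Or.inl h
    · exact Or.inr ⟨_, hk, h⟩
  · rintro (h | ⟨k, hk, h⟩)
    · exact MemD.base h
    · exact MemD.step hk h

/-- The number of elements of `D_v` less than `v`. -/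
noncomputable def binv {n : ℕ} (p : Fin n → ℕ) (v : Fin (n + 1)) : ℕ :=
  ((D p v).filter fun j => j < v).card

/-- The number of elements of `D_v` greater than `v`. -/
noncomputable def cobinv {n : ℕ} (p : Fin n → ℕ) (v : Fin (n + 1)) : ℕ :=
  ((D p v).filter fun j => v < j).card

/-- The statistic `pinv`. -/
noncomputable def pinv {n : ℕ} (p : Fin n → ℕ) : ℕ := ∑ v, binv p v

/-- The statistic `copinv`. -/
noncomputable def copinv {n : ℕ} (p : Fin n → ℕ) : ℕ := ∑ v, cobinv p v

/-- The enumerator `B_n(q, t)` of parking functions by `pinv` and `copinv`. -/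
noncomputable def parkPoly (n : ℕ) : MvPolynomial (Fin 2) ℤ :=
  ∑ p ∈ parkingFunctions n, q ^ pinv p * t ^ copinv p

end ParkingFunctions

end BounceRef

set_option linter.unusedSectionVars false

/-! A tree is encoded by its parent map `P` towards 0, and each of the three polynomials becomes a
sum over trees of a product over edges. For a vertex `x ≠ 0` with subtree `B`, `vertexWeight`
contributes a factor q or t for every element of `B`, according to its comparison with `P x`. As
each pair (ancestor, strict descendant) belongs to exactly one edge, the edge leaving the ancestor
towards the descendant, the product is q^inv t^coinv. By contrast `rootWeight` contributes |B| equal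
factors, decided by comparing `x` alone with `P x`.

The two weights have the same total (`weightSum_eq_forestEnum`). For either one, the trees on `S`
rooted at `r` have total weight `rankMonomial S r`, that is, q^(number of smaller elements)
t^(number of larger elements), times a polynomial depending only on |S|. Cutting off the branch `B`
at `r` that contains a fixed vertex gives a recursion. Induction needs only the block identity Σ_c
φ(r,B,c) · rankMonomial(B,c) = rankMonomial(B,r) · [|B|], the sum being over the possible roots `c`
of `B`. It holds for both weights (`sum_vertexWeight`, `sum_rootWeight`).

For a parking function the word lists the vertices of a tree in breadth-first order and the sets D_v
are the sets of strict descendants, so B_n, like I_n, is the sum for `vertexWeight`.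

For factorizations, a tree is laid out in inorder on a line, each subtree filling an interval; the
factor of `x` exchanges the two ends of the interval of `x`. Following tokens shows that the product
is the full cycle, and the areas become the exponents of `rootWeight`. Containment of intervals
recovers the tree, so this map is injective. Dénes' double count (`card_factorizations_le`) bounds
the number of factorizations by the number of trees, hence the map is bijective and F_n is the sum
for `rootWeight`. -/

namespace ParentTree

/-- `Below p x y`: iterating the parent map `p` from `y` one meets `x`. -/
inductive Below {α : Type*} (p : α → α) (x : α) : α → Prop
  | refl : Below p x x
  | step {y : α} : Below p x (p y) → Below p x y

/-! ### The ancestor relation of a parent map -/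

section Below

variable {α : Type*} {p : α → α}

theorem Below.trans {x y z : α} (h : Below p x y) (h' : Below p y z) : Below p x z := by
  induction h' with
  | refl => exact h
  | step _ ih => exact ih.step

theorem below_parent (p : α → α) (x : α) : Below p (p x) x := Below.refl.step

theorem below_iff {x y : α} : Below p x y ↔ x = y ∨ Below p x (p y) := by
  constructor
  · intro h
    cases h with
    | refl => exact Or.inl rfl
    | step h => exact Or.inr h
  · rintro (rfl | h)
    · exact .refl
    · exact h.step

/-- The ancestors of `z` form a chain, because climbing from `z` involves no choice. -/
theorem Below.total {x y z : α} (h : Below p x z) (h' : Below p y z) :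
    Below p x y ∨ Below p y x := by
  induction h with
  | refl => exact Or.inr h'
  | step h ih =>
    cases h' with
    | refl => exact Or.inl h.step
    | step h' => exact ih h'

theorem Below.eq_of_fixed {x r : α} (hr : p r = r) (h : Below p x r) : x = r := by
  generalize hy : r = y at h
  induction h with
  | refl => rfl
  | step h ih => subst hy; exact (ih hr.symm).trans hr

/-- Below a common root, the relation `Below` is antisymmetric. -/
theorem Below.antisymm {r x y : α} (hr : p r = r) (hx : Below p r x) (h : Below p x y)
    (h' : Below p y x) : x = y := by
  induction hx generalizing y with
  | refl => exact (h'.eq_of_fixed hr).symm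
  | @step x _ ih =>
    rcases below_iff.1 h' with rfl | h''
    · rfl
    · have h1 := ih ((below_parent p x).trans h) h''
      subst h1
      exact (ih (below_parent p x) h).symm

/-- A strict descendant of `x` lies below a child of `x`. -/
theorem Below.exists_child {r x y : α} (hr : p r = r) (h : Below p x y) (hne : x ≠ y) :
    ∃ z, z ≠ r ∧ p z = x ∧ Below p z y := by
  induction h with
  | refl => exact absurd rfl hne
  | @step y h ih =>
    by_cases hx : x = p y
    · refine ⟨y, ?_, hx.symm, .refl⟩
      rintro rfl
      exact hne (hx.trans hr)
    · obtain ⟨z, hz, hzx, hzy⟩ := ih hx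
      exact ⟨z, hz, hzx, hzy.step⟩

/-- A child of `x` is not above `x`. -/
theorem not_below_parent {r x : α} (hr : p r = r) (hx : Below p r x) (hne : x ≠ r) :
    ¬ Below p x (p x) := by
  intro h
  have h1 := hx.antisymm hr h (below_parent p x)
  have : ∀ y, Below p r y → p y = y → y = r := by
    intro y hy
    induction hy with
    | refl => intro; rfl
    | step _ ih => intro h; rw [h] at ih; exact ih h
  exact hne (this x hx h1.symm)

/-- Two children of `x` above a common vertex coincide. -/
theorem child_unique {r c d y : α} (hr : p r = r) (hc : Below p r c) (hd : Below p r d)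
    (hcr : c ≠ r) (hdr : d ≠ r) (hcd : p c = p d) (h : Below p c y) (h' : Below p d y) :
    c = d := by
  rcases h.total h' with h1 | h1
  · rcases below_iff.1 h1 with h2 | h2
    · exact h2
    · rw [← hcd] at h2
      exact absurd h2 (not_below_parent hr hc hcr)
  · rcases below_iff.1 h1 with h2 | h2
    · exact h2.symm
    · rw [hcd] at h2
      exact absurd h2 (not_below_parent hr hd hdr)

/-- The relation `Below` determines the parent map. -/
theorem eq_of_below_iff {p' : α → α} {r : α} (hr : p r = r) (hr' : p' r = r)
    (h : ∀ x, Below p r x) (h' : ∀ x, Below p' r x)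
    (hb : ∀ x y, Below p x y ↔ Below p' x y) : p = p' := by
  funext x
  by_cases hx : x = r
  · rw [hx, hr, hr']
  have h1 : Below p (p x) (p' x) := by
    have h2 := (hb _ _).1 (below_parent p x)
    rcases below_iff.1 h2 with h3 | h3
    · exact absurd (show Below p x (p x) by rw [h3]; exact .refl)
        (not_below_parent hr (h x) hx)
    · exact (hb _ _).2 h3
  have h1' : Below p (p' x) (p x) := by
    have h2 := (hb _ _).2 (below_parent p' x)
    rcases below_iff.1 h2 with h3 | h3
    · exact absurd (show Below p' x (p' x) by rw [h3]; exact .refl)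
        (not_below_parent hr' (h' x) hx)
    · exact h3
  exact (h _).antisymm hr h1 h1'

end Below

/-- `p` is the parent map of a tree with vertex set `S` and root `r` (extended by the identity
outside of `S`). -/
structure IsRootedTree {α : Type*} (S : Finset α) (r : α) (p : α → α) : Prop where
  root_mem : r ∈ S
  root : p r = r
  mapsTo : ∀ x ∈ S, p x ∈ S
  off : ∀ x, x ∉ S → p x = x
  reach : ∀ x ∈ S, Below p r x

namespace IsRootedTree

variable {α : Type*} {S : Finset α} {r : α} {p : α → α}

theorem mem_of_below (h : IsRootedTree S r p) {x y : α} (hxy : Below p x y) (hy : y ∈ S) :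
    x ∈ S := by
  induction hxy with
  | refl => exact hy
  | step _ ih => exact ih (h.mapsTo _ hy)

theorem mem_of_below' (h : IsRootedTree S r p) {x y : α} (hxy : Below p x y) (hx : x ∈ S) :
    y ∈ S := by
  by_contra hy
  rw [hxy.eq_of_fixed (h.off y hy)] at hx
  exact hy hx

end IsRootedTree

/-! ### Edge weights, grafting, and the decomposition by a branch at the root -/

section Sums

variable {α : Type*} [Fintype α] [DecidableEq α]

open Classical in
/-- The vertices of the subtree at `x`. -/
noncomputable def sub (p : α → α) (x : α) : Finset α := Finset.univ.filter (Below p x)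

@[simp] theorem mem_sub {p : α → α} {x y : α} : y ∈ sub p x ↔ Below p x y := by simp [sub]

open Classical in
/-- The parent maps of trees on `S` rooted at `r`. -/
noncomputable def rootedTrees (S : Finset α) (r : α) : Finset (α → α) :=
  Finset.univ.filter (IsRootedTree S r)

@[simp] theorem mem_rootedTrees {S : Finset α} {r : α} {p : α → α} :
    p ∈ rootedTrees S r ↔ IsRootedTree S r p := by simp [rootedTrees]

variable {R : Type*} [CommRing R]

/-- A multiplicative weight, a product over the edges of the tree: the factor depends on the
parent, the vertex set of the subtree at the child, and the child. -/
noncomputable def weight (φ : α → Finset α → α → R) (S : Finset α) (r : α) (p : α → α) : R :=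
  ∏ x ∈ S.erase r, φ (p x) (sub p x) x

/-- The total weight of all trees on `S` rooted at `r`. -/
noncomputable def weightSum (φ : α → Finset α → α → R) (S : Finset α) (r : α) : R :=
  ∑ p ∈ rootedTrees S r, weight φ S r p

/-- Restriction of a parent map to `B`, with root `c`. -/
def restrict (p : α → α) (B : Finset α) (c : α) : α → α :=
  fun x => if x ∈ B ∧ x ≠ c then p x else x

/-- The tree obtained by attaching the tree `p₁` on `B` rooted at `c` to the vertex `r` of `p₂`. -/
def graft (B : Finset α) (c r : α) (p₁ p₂ : α → α) : α → α :=
  fun x => if x = c then r else if x ∈ B then p₁ x else p₂ x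

section Graft

variable {S B : Finset α} {r c : α} {p₁ p₂ : α → α}

theorem graft_root (hr : r ∉ B) (hc : c ∈ B) (h₂ : p₂ r = r) : graft B c r p₁ p₂ r = r := by
  rw [graft, if_neg (by rintro rfl; exact hr hc), if_neg hr, h₂]

theorem graft_of_mem {x : α} (hx : x ∈ B) (hxc : x ≠ c) : graft B c r p₁ p₂ x = p₁ x := by
  rw [graft, if_neg hxc, if_pos hx]

theorem graft_of_notMem {x : α} (hc : c ∈ B) (hx : x ∉ B) : graft B c r p₁ p₂ x = p₂ x := by
  rw [graft, if_neg (by rintro rfl; exact hx hc), if_neg hx]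

theorem graft_below_left (h₁ : IsRootedTree B c p₁) (hr : r ∉ B) (h₂ : p₂ r = r) {x y : α}
    (hx : x ∈ B) (hy : y ∈ B) : Below (graft B c r p₁ p₂) x y ↔ Below p₁ x y := by
  have hc := h₁.root_mem
  constructor
  · intro h
    induction h with
    | refl => exact .refl
    | @step y h ih =>
      by_cases hyc : y = c
      · subst hyc
        rw [graft, if_pos rfl] at h
        exact absurd (h.eq_of_fixed (graft_root hr hc h₂) ▸ hx) hr
      · rw [graft_of_mem hy hyc] at ih
        exact (ih (h₁.mapsTo _ hy)).step
  · intro h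
    induction h with
    | refl => exact .refl
    | @step y h ih =>
      by_cases hyc : y = c
      · subst hyc
        simpa only [h₁.root] using ih (h₁.mapsTo _ hy)
      · refine .step ?_
        rw [graft_of_mem hy hyc]
        exact ih (h₁.mapsTo _ hy)

theorem IsRootedTree.notMem_map (h₂ : IsRootedTree (S \ B) r p₂) {y : α} (hy : y ∉ B) :
    p₂ y ∉ B := by
  by_cases hyS : y ∈ S
  · exact (Finset.mem_sdiff.1 (h₂.mapsTo y (Finset.mem_sdiff.2 ⟨hyS, hy⟩))).2
  · rwa [h₂.off y (by simp [hyS])]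

theorem graft_below_right (hc : c ∈ B) (h₂ : IsRootedTree (S \ B) r p₂) {x y : α}
    (hy : y ∉ B) : Below (graft B c r p₁ p₂) x y ↔ Below p₂ x y := by
  constructor
  · intro h
    induction h with
    | refl => exact .refl
    | @step y h ih =>
      rw [graft_of_notMem hc hy] at ih
      exact (ih (h₂.notMem_map hy)).step
  · intro h
    induction h with
    | refl => exact .refl
    | @step y h ih =>
      refine .step ?_
      rw [graft_of_notMem hc hy]
      exact ih (h₂.notMem_map hy)

theorem graft_sub_left (h₁ : IsRootedTree B c p₁) (h₂ : IsRootedTree (S \ B) r p₂) {x : α}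
    (hx : x ∈ B) : sub (graft B c r p₁ p₂) x = sub p₁ x := by
  have hr : r ∉ B := (Finset.mem_sdiff.1 h₂.root_mem).2
  ext y
  simp only [mem_sub]
  by_cases hy : y ∈ B
  · exact graft_below_left h₁ hr h₂.root hx hy
  · rw [graft_below_right h₁.root_mem h₂ hy]
    constructor
    · intro h
      by_cases hyS : y ∈ S \ B
      · exact absurd hx (Finset.mem_sdiff.1 (h₂.mem_of_below h hyS)).2
      · exact absurd (h.eq_of_fixed (h₂.off y hyS) ▸ hx) hy
    · intro h
      exact absurd (h₁.mem_of_below' h hx) hy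

theorem sub_root (h₁ : IsRootedTree B c p₁) : sub p₁ c = B := by
  ext y
  rw [mem_sub]
  exact ⟨fun h => h₁.mem_of_below' h h₁.root_mem, h₁.reach y⟩

theorem graft_isRootedTree (h₁ : IsRootedTree B c p₁) (h₂ : IsRootedTree (S \ B) r p₂)
    (hB : B ⊆ S) : IsRootedTree S r (graft B c r p₁ p₂) := by
  obtain ⟨hrS, hr⟩ := Finset.mem_sdiff.1 h₂.root_mem
  refine ⟨hrS, graft_root hr h₁.root_mem h₂.root, ?_, ?_, ?_⟩
  · intro x hx
    unfold graft
    split_ifs with h h'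
    · exact hrS
    · exact hB (h₁.mapsTo x h')
    · exact (Finset.mem_sdiff.1 (h₂.mapsTo x (by simp [hx, h']))).1
  · intro x hx
    rw [graft_of_notMem h₁.root_mem (fun h => hx (hB h)), h₂.off x (by simp [hx])]
  · intro y hy
    by_cases hyB : y ∈ B
    · have h3 : Below (graft B c r p₁ p₂) c y :=
        (graft_below_left h₁ hr h₂.root h₁.root_mem hyB).2 (h₁.reach y hyB)
      refine Below.trans (.step ?_) h3
      rw [graft, if_pos rfl]
      exact .refl
    · exact (graft_below_right h₁.root_mem h₂ hyB).2 (h₂.reach y (by simp [hy, hyB]))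

/-- The branch `B` hangs directly from `r`, so `r` is the only vertex outside `B` whose subtree
grows. -/
theorem graft_sub_right (h₁ : IsRootedTree B c p₁) (h₂ : IsRootedTree (S \ B) r p₂)
    (hB : B ⊆ S) {x : α} (hx : x ∈ S \ B) (hxr : x ≠ r) :
    sub (graft B c r p₁ p₂) x = sub p₂ x := by
  have hg := graft_isRootedTree h₁ h₂ hB
  obtain ⟨hrS, hr⟩ := Finset.mem_sdiff.1 h₂.root_mem
  obtain ⟨hxS, hxB⟩ := Finset.mem_sdiff.1 hx
  ext y
  simp only [mem_sub]
  by_cases hy : y ∈ B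
  · refine iff_of_false (fun h => ?_) (fun h => ?_)
    · have h3 : Below (graft B c r p₁ p₂) c y :=
        (graft_below_left h₁ hr h₂.root h₁.root_mem hy).2 (h₁.reach y hy)
      rcases h.total h3 with h4 | h4
      · rcases below_iff.1 h4 with rfl | h5
        · exact hxB h₁.root_mem
        · rw [graft, if_pos rfl] at h5
          exact hxr (h5.eq_of_fixed hg.root)
      · rw [graft_below_right h₁.root_mem h₂ hxB] at h4
        exact (Finset.mem_sdiff.1 (h₂.mem_of_below h4 hx)).2 h₁.root_mem
    · exact (Finset.mem_sdiff.1 (h₂.mem_of_below' h hx)).2 hy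
  · exact graft_below_right h₁.root_mem h₂ hy

theorem restrict_graft_left (h₁ : IsRootedTree B c p₁) :
    restrict (graft B c r p₁ p₂) B c = p₁ := by
  funext x
  unfold restrict
  split_ifs with h
  · exact graft_of_mem h.1 h.2
  · by_cases hx : x ∈ B
    · have : x = c := by tauto
      rw [this, h₁.root]
    · exact (h₁.off x hx).symm

theorem restrict_graft_right (hc : c ∈ B) (h₂ : IsRootedTree (S \ B) r p₂) :
    restrict (graft B c r p₁ p₂) (S \ B) r = p₂ := by
  funext x
  unfold restrict
  split_ifs with h
  · exact graft_of_notMem hc (Finset.mem_sdiff.1 h.1).2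
  · by_cases hx : x ∈ S \ B
    · have : x = r := by tauto
      rw [this, h₂.root]
    · exact (h₂.off x hx).symm

section Restrict

variable {p : α → α}

theorem restrict_isRootedTree_left (hB : sub p c = B) :
    IsRootedTree B c (restrict p B c) := by
  subst hB
  refine ⟨by simp [Below.refl], by simp [restrict], ?_, ?_, ?_⟩
  · intro x hx
    unfold restrict
    split_ifs with h1
    · rw [mem_sub] at hx ⊢
      exact (below_iff.1 hx).resolve_left h1.2.symm
    · exact hx
  · intro x hx
    simp [restrict, hx]
  · intro y hy
    rw [mem_sub] at hy
    induction hy with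
    | refl => exact .refl
    | @step y hy ih =>
      by_cases hyc : y = c
      · rw [hyc]; exact .refl
      · refine .step ?_
        rw [restrict, if_pos ⟨by rw [mem_sub]; exact hy.step, hyc⟩]
        exact ih

theorem restrict_isRootedTree_right (h : IsRootedTree S r p) (hcr : c ≠ r)
    (hB : sub p c = B) : IsRootedTree (S \ B) r (restrict p (S \ B) r) := by
  subst hB
  have key : ∀ x ∈ S \ sub p c, p x ∈ S \ sub p c := by
    intro x hx
    rw [Finset.mem_sdiff, mem_sub] at hx ⊢
    exact ⟨h.mapsTo x hx.1, fun h' => hx.2 h'.step⟩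
  refine ⟨?_, by simp [restrict], ?_, ?_, ?_⟩
  · rw [Finset.mem_sdiff, mem_sub]
    exact ⟨h.root_mem, fun h' => hcr (h'.eq_of_fixed h.root)⟩
  · intro x hx
    unfold restrict
    split_ifs with h1
    · exact key x hx
    · exact hx
  · intro x hx
    rw [restrict, if_neg (fun h => hx h.1)]
  · intro y hy
    have hr := h.reach y (Finset.mem_sdiff.1 hy).1
    induction hr with
    | refl => exact .refl
    | @step y _ ih =>
      by_cases hyr : y = r
      · rw [hyr]; exact .refl
      · refine .step ?_
        rw [restrict, if_pos ⟨hy, hyr⟩]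
        exact ih (key y hy)

theorem graft_restrict (h : IsRootedTree S r p) (hcr : p c = r) :
    graft B c r (restrict p B c) (restrict p (S \ B) r) = p := by
  funext x
  unfold graft restrict
  split_ifs with h1 h2 h3 h4
  · rw [h1, hcr]
  · rfl
  · exact absurd ⟨h2, h1⟩ h3
  · rfl
  · by_cases hxr : x = r
    · rw [hxr, h.root]
    · refine (h.off x fun hx => h4 ⟨?_, hxr⟩).symm
      simp [hx, h2]

end Restrict

/-- Grafting changes neither the parent nor the subtree of any old non-root vertex; the first factor
on the right belongs to the new edge from `c` to `r`. -/
theorem weight_graft (φ : α → Finset α → α → R) (h₁ : IsRootedTree B c p₁)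
    (h₂ : IsRootedTree (S \ B) r p₂) (hB : B ⊆ S) :
    weight φ S r (graft B c r p₁ p₂) = φ r B c * weight φ B c p₁ * weight φ (S \ B) r p₂ := by
  obtain ⟨hrS, hr⟩ := Finset.mem_sdiff.1 h₂.root_mem
  have hS : S.erase r = B ∪ (S \ B).erase r := by
    ext x
    simp only [Finset.mem_erase, Finset.mem_union, Finset.mem_sdiff]
    have : x ∈ B → x ∈ S ∧ x ≠ r := fun h => ⟨hB h, by rintro rfl; exact hr h⟩
    tauto
  have hd : Disjoint B ((S \ B).erase r) := by
    rw [Finset.disjoint_left]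
    intro x hx hx'
    exact (Finset.mem_sdiff.1 (Finset.mem_of_mem_erase hx')).2 hx
  unfold weight
  rw [hS, Finset.prod_union hd, ← Finset.mul_prod_erase B _ h₁.root_mem]
  congr 1
  · congr 1
    · rw [graft_sub_left h₁ h₂ h₁.root_mem, sub_root h₁, graft, if_pos rfl]
    · refine Finset.prod_congr rfl fun x hx => ?_
      obtain ⟨hxc, hxB⟩ := Finset.mem_erase.1 hx
      rw [graft_sub_left h₁ h₂ hxB, graft_of_mem hxB hxc]
  · refine Finset.prod_congr rfl fun x hx => ?_
    obtain ⟨hxr, hx⟩ := Finset.mem_erase.1 hx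
    rw [graft_sub_right h₁ h₂ hB hx hxr,
      graft_of_notMem h₁.root_mem (Finset.mem_sdiff.1 hx).2]

end Graft

theorem exists_top {S : Finset α} {r : α} {p : α → α} (h : IsRootedTree S r p) {m : α}
    (hm : m ∈ S) (hmr : m ≠ r) : ∃ c, c ≠ r ∧ p c = r ∧ Below p c m :=
  (h.reach m hm).exists_child h.root hmr.symm

/-- Decomposition of a tree on `S` by means of the branch at the root that contains `m`. -/
theorem weightSum_eq (φ : α → Finset α → α → R) {S : Finset α} {r m : α} (hr : r ∈ S)
    (hm : m ∈ S) (hmr : m ≠ r) :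
    weightSum φ S r = ∑ B ∈ (S.erase r).powerset.filter (m ∈ ·),
      (∑ c ∈ B, φ r B c * weightSum φ B c) * weightSum φ (S \ B) r := by
  classical
  -- The root of the branch containing `m`, as a total function of `p`; when `p` is not a rooted
  -- tree the value `r` is a dummy.
  have top : ∀ p : α → α, ∃ c, IsRootedTree S r p → c ≠ r ∧ p c = r ∧ Below p c m := by
    intro p
    by_cases h : IsRootedTree S r p
    · obtain ⟨c, hc⟩ := exists_top h hm hmr
      exact ⟨c, fun _ => hc⟩
    · exact ⟨r, fun h' => absurd h' h⟩
  choose top htop using top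
  rw [weightSum, ← Finset.sum_fiberwise_of_maps_to (s := rootedTrees S r)
    (t := (S.erase r).powerset.filter (m ∈ ·)) (g := fun p => sub p (top p)) ?_]
  · refine Finset.sum_congr rfl fun B hB => ?_
    rw [Finset.mem_filter, Finset.mem_powerset] at hB
    obtain ⟨hBS', hmB⟩ := hB
    have hBS : B ⊆ S := hBS'.trans (Finset.erase_subset _ _)
    have hrB : r ∉ B := fun h => (Finset.mem_erase.1 (hBS' h)).1 rfl
    -- With the vertex set `B` of the branch fixed, the trees are sorted by the root `c` of the
    -- branch; each class is a product of two sets of trees, by restriction and grafting.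
    rw [← Finset.sum_fiberwise_of_maps_to (t := B) (g := top) ?_, Finset.sum_mul]
    · refine Finset.sum_congr rfl fun c hc => ?_
      have hcr : c ≠ r := by rintro rfl; exact hrB hc
      rw [weightSum, weightSum, mul_assoc, Finset.sum_mul_sum, ← Finset.sum_product',
        Finset.mul_sum]
      refine Finset.sum_bij' (fun p _ => (restrict p B c, restrict p (S \ B) r))
        (fun x _ => graft B c r x.1 x.2) ?_ ?_ ?_ ?_ ?_
      · intro p hp
        simp only [Finset.mem_filter, mem_rootedTrees] at hp
        obtain ⟨⟨hp, hB⟩, rfl⟩ := hp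
        simp only [Finset.mem_product, mem_rootedTrees]
        exact ⟨restrict_isRootedTree_left hB,
          restrict_isRootedTree_right hp hcr hB⟩
      · rintro ⟨p₁, p₂⟩ hp
        simp only [Finset.mem_product, mem_rootedTrees] at hp
        obtain ⟨h₁, h₂⟩ := hp
        have hg := graft_isRootedTree h₁ h₂ hBS
        have hsub : sub (graft B c r p₁ p₂) c = B := by
          rw [graft_sub_left h₁ h₂ hc, sub_root h₁]
        have ht := htop _ hg
        have htc : top (graft B c r p₁ p₂) = c := by
          refine child_unique hg.root (hg.reach _ ?_) (hg.reach _ (hBS hc)) ht.1 hcr ?_ ht.2.2 ?_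
          · exact hg.mem_of_below ht.2.2 hm
          · rw [ht.2.1, graft, if_pos rfl]
          · rw [← mem_sub, hsub]; exact hmB
        simp only [Finset.mem_filter, mem_rootedTrees]
        exact ⟨⟨hg, by rw [htc, hsub]⟩, htc⟩
      · intro p hp
        simp only [Finset.mem_filter, mem_rootedTrees] at hp
        obtain ⟨⟨hp, hB⟩, rfl⟩ := hp
        exact graft_restrict hp (htop p hp).2.1
      · rintro ⟨p₁, p₂⟩ hp
        simp only [Finset.mem_product, mem_rootedTrees] at hp
        obtain ⟨h₁, h₂⟩ := hp
        simp only [restrict_graft_left h₁, restrict_graft_right hc h₂]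
      · intro p hp
        simp only [Finset.mem_filter, mem_rootedTrees] at hp
        obtain ⟨⟨hp, hB⟩, rfl⟩ := hp
        have h₁ := restrict_isRootedTree_left hB
        have h₂ := restrict_isRootedTree_right hp hcr hB
        conv_lhs => rw [← graft_restrict (B := B) hp (htop p hp).2.1]
        rw [weight_graft φ h₁ h₂ hBS, mul_assoc]
    · intro p hp
      simp only [Finset.mem_filter, mem_rootedTrees] at hp
      rw [← hp.2, mem_sub]
      exact .refl
  · intro p hp
    rw [mem_rootedTrees] at hp
    obtain ⟨h1, h2, h3⟩ := htop p hp
    rw [Finset.mem_filter, Finset.mem_powerset, mem_sub]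
    refine ⟨fun y hy => ?_, h3⟩
    rw [mem_sub] at hy
    rw [Finset.mem_erase]
    refine ⟨?_, hp.mem_of_below' hy (hp.mem_of_below h3 hm)⟩
    rintro rfl
    exact h1 (hy.eq_of_fixed hp.root)

end Sums

/-! ### The block identity and equality of the two weighted sums -/

section Algebra

variable {R : Type*} [CommRing R] (q t : R)

/-- The homogeneous `q,t`-analogue of the integer `m`. -/
def qtInt (m : ℕ) : R := ∑ i ∈ Finset.range m, q ^ i * t ^ (m - 1 - i)

theorem qtInt_add (m k : ℕ) : qtInt q t (m + k) = t ^ k * qtInt q t m + q ^ m * qtInt q t k := by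
  unfold qtInt
  rw [Finset.sum_range_add, Finset.mul_sum, Finset.mul_sum]
  congr 1
  · refine Finset.sum_congr rfl fun i hi => ?_
    rw [Finset.mem_range] at hi
    rw [show m + k - 1 - i = k + (m - 1 - i) by omega, pow_add]
    ring
  · refine Finset.sum_congr rfl fun i hi => ?_
    rw [show m + k - 1 - (m + i) = k - 1 - i by omega, pow_add]
    ring

theorem qtInt_one : qtInt q t 1 = 1 := by simp [qtInt]

variable {α : Type*} [Fintype α] [LinearOrder α]

/-- The monomial recording how many elements of `B` are smaller and larger than `c`. -/
def rankMonomial (B : Finset α) (c : α) : R :=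
  q ^ (B.filter (· < c)).card * t ^ (B.filter (c < ·)).card

theorem rankMonomial_union {B B' : Finset α} (h : Disjoint B B') (c : α) :
    rankMonomial q t (B ∪ B') c = rankMonomial q t B c * rankMonomial q t B' c := by
  unfold rankMonomial
  rw [Finset.filter_union, Finset.filter_union,
    Finset.card_union_of_disjoint (Finset.disjoint_filter_filter h),
    Finset.card_union_of_disjoint (Finset.disjoint_filter_filter h), pow_add, pow_add]
  ring

theorem rankMonomial_of_lt {B : Finset α} {c : α} (h : ∀ x ∈ B, x < c) :
    rankMonomial q t B c = q ^ B.card := by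
  unfold rankMonomial
  rw [Finset.filter_true_of_mem h, Finset.filter_false_of_mem fun x hx => (h x hx).not_gt]
  simp

theorem rankMonomial_of_gt {B : Finset α} {c : α} (h : ∀ x ∈ B, c < x) :
    rankMonomial q t B c = t ^ B.card := by
  unfold rankMonomial
  rw [Finset.filter_true_of_mem h, Finset.filter_false_of_mem fun x hx => (h x hx).not_gt]
  simp

theorem rankMonomial_singleton (c : α) : rankMonomial q t {c} c = 1 := by
  simp [rankMonomial, Finset.filter_singleton]

/-- The element of rank i contributes q^i t^(|B|-1-i). In the induction a new maximum multiplies the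
old terms by t and adds the term q^|s|. -/
theorem sum_rankMonomial (B : Finset α) : ∑ c ∈ B, rankMonomial q t B c = qtInt q t B.card := by
  induction B using Finset.induction_on_max with
  | empty => simp [qtInt]
  | insert a s ha ih =>
    have has : a ∉ s := fun h => lt_irrefl a (ha a h)
    have hd : Disjoint s {a} := by simpa using has
    rw [Finset.insert_eq, Finset.union_comm, Finset.sum_union hd,
      Finset.card_union_of_disjoint hd, Finset.card_singleton, qtInt_add, qtInt_one, ← ih,
      Finset.mul_sum, Finset.sum_singleton]
    congr 1
    · refine Finset.sum_congr rfl fun c hc => ?_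
      rw [rankMonomial_union q t hd, rankMonomial_of_gt q t (B := {a}) (by simpa using ha c hc)]
      simp [mul_comm]
    · rw [rankMonomial_union q t hd, rankMonomial_of_lt q t ha, rankMonomial_singleton]

/-- The weight of the branch `B` at `r`: each vertex of `B` is compared with `r`. -/
def vertexWeight (r : α) (B : Finset α) (_ : α) : R := rankMonomial q t B r

/-- The weight of the branch `B` at `r`: the root `c` of `B` is compared with `r`. -/
def rootWeight (r : α) (B : Finset α) (c : α) : R := if c < r then q ^ B.card else t ^ B.card

theorem sum_vertexWeight (r : α) (B : Finset α) :
    ∑ c ∈ B, vertexWeight q t r B c * rankMonomial q t B c =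
      rankMonomial q t B r * qtInt q t B.card := by
  simp_rw [vertexWeight]
  rw [← Finset.mul_sum, sum_rankMonomial]

/-- Let `L` and `U` be the parts of `B` below and above `r`. After q^|L| t^|U| is taken out, the
roots in `L` contribute q^|U| [|L|] and those in `U` contribute t^|L| [|U|], and these add up to
[|U| + |L|] by `qtInt_add`. -/
theorem sum_rootWeight {r : α} {B : Finset α} (hr : r ∉ B) :
    ∑ c ∈ B, rootWeight q t r B c * rankMonomial q t B c =
      rankMonomial q t B r * qtInt q t B.card := by
  obtain ⟨L, hL⟩ : ∃ L, L = B.filter (· < r) := ⟨_, rfl⟩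
  obtain ⟨U, hU⟩ : ∃ U, U = B.filter (r < ·) := ⟨_, rfl⟩
  have hB : B = L ∪ U := by
    subst hL hU
    ext x
    simp only [Finset.mem_union, Finset.mem_filter]
    have : x ∈ B → x < r ∨ r < x := fun h => lt_or_gt_of_ne (by rintro rfl; exact hr h)
    tauto
  have hLr : ∀ x ∈ L, x < r := by subst hL; simp
  have hUr : ∀ x ∈ U, r < x := by subst hU; simp
  have hd : Disjoint L U := Finset.disjoint_left.2 fun x h h' => (hLr x h).not_gt (hUr x h')
  have e1 : ∑ c ∈ L, rootWeight q t r B c * rankMonomial q t B c =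
      q ^ B.card * t ^ U.card * qtInt q t L.card := by
    rw [← sum_rankMonomial, Finset.mul_sum]
    refine Finset.sum_congr rfl fun c hc => ?_
    rw [rootWeight, if_pos (hLr c hc)]
    conv_lhs => rw [hB, rankMonomial_union q t hd,
      rankMonomial_of_gt q t (fun x hx => (hLr c hc).trans (hUr x hx))]
    rw [← hB]; ring
  have e2 : ∑ c ∈ U, rootWeight q t r B c * rankMonomial q t B c =
      t ^ B.card * q ^ L.card * qtInt q t U.card := by
    rw [← sum_rankMonomial, Finset.mul_sum]
    refine Finset.sum_congr rfl fun c hc => ?_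
    rw [rootWeight, if_neg (hUr c hc).not_gt]
    conv_lhs => rw [hB, rankMonomial_union q t hd,
      rankMonomial_of_lt q t (fun x hx => (hLr x hx).trans (hUr c hc))]
    rw [← hB]; ring
  have e3 : rankMonomial q t B r = q ^ L.card * t ^ U.card := by
    rw [hB, rankMonomial_union q t hd, rankMonomial_of_lt q t hLr, rankMonomial_of_gt q t hUr]
  have e4 : B.card = U.card + L.card := by rw [hB, Finset.card_union_of_disjoint hd, add_comm]
  have e5 : ∑ c ∈ B, rootWeight q t r B c * rankMonomial q t B c =
      ∑ c ∈ L, rootWeight q t r B c * rankMonomial q t B c +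
      ∑ c ∈ U, rootWeight q t r B c * rankMonomial q t B c := by
    conv_lhs => enter [1]; rw [hB]
    rw [Finset.sum_union hd]
  rw [e5, e1, e2, e3, e4, qtInt_add, pow_add, pow_add]
  ring

/-- The enumerator of rooted forests with `k` vertices. -/
def forestEnum : ℕ → R
  | 0 => 1
  | k + 1 => ∑ j : Fin (k + 1), (k.choose j : R) *
      (qtInt q t (j + 1) * forestEnum j * forestEnum (k - j))

theorem forestEnum_succ (k : ℕ) : forestEnum q t (k + 1) =
    ∑ j ∈ Finset.range (k + 1), k.choose j •
      (qtInt q t (j + 1) * forestEnum q t j * forestEnum q t (k - j)) := by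
  rw [forestEnum, Finset.sum_range]
  simp [nsmul_eq_mul]

/-- Deleting the marked element `m` turns the sum into one over all subsets, which can be grouped by
cardinality with binomial coefficients. -/
theorem sum_blocks (T : Finset α) (m : α) (hm : m ∈ T) (g : ℕ → R) :
    ∑ B ∈ T.powerset.filter (m ∈ ·), g B.card =
      ∑ B ∈ (T.erase m).powerset, g (B.card + 1) := by
  symm
  refine Finset.sum_bij' (fun B _ => insert m B) (fun B _ => B.erase m) ?_ ?_ ?_ ?_ ?_
  · intro B hB
    rw [Finset.mem_powerset] at hB
    simp only [Finset.mem_filter, Finset.mem_powerset, Finset.mem_insert_self, and_true]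
    exact Finset.insert_subset hm (hB.trans (Finset.erase_subset _ _))
  · intro B hB
    rw [Finset.mem_filter, Finset.mem_powerset] at hB
    rw [Finset.mem_powerset]
    exact Finset.erase_subset_erase m hB.1
  · intro B hB
    rw [Finset.mem_powerset] at hB
    exact Finset.erase_insert fun h => (Finset.mem_erase.1 (hB h)).1 rfl
  · intro B hB
    rw [Finset.mem_filter] at hB
    exact Finset.insert_erase hB.2
  · intro B hB
    rw [Finset.mem_powerset] at hB
    rw [Finset.card_insert_of_notMem fun h => (Finset.mem_erase.1 (hB h)).1 rfl]

theorem weightSum_singleton (φ : α → Finset α → α → R) (r : α) : weightSum φ {r} r = 1 := by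
  have h : rootedTrees {r} r = {(id : α → α)} := by
    ext p
    rw [mem_rootedTrees, Finset.mem_singleton]
    constructor
    · intro h
      funext x
      by_cases hx : x = r
      · rw [hx, h.root]; rfl
      · exact h.off x (by simpa using hx)
    · rintro rfl
      exact ⟨by simp, rfl, fun x hx => hx, fun x _ => rfl, fun x hx => by
        rw [Finset.mem_singleton.1 hx]; exact .refl⟩
  rw [weightSum, h, Finset.sum_singleton, weight]
  simp

/-- The enumerator of trees with a given root, for every weight of branches with the right block
sums. -/
theorem weightSum_eq_forestEnum (φ : α → Finset α → α → R)
    (hφ : ∀ r B, r ∉ B → ∑ c ∈ B, φ r B c * rankMonomial q t B c =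
      rankMonomial q t B r * qtInt q t B.card) (S : Finset α) (r : α) (hr : r ∈ S) :
    weightSum φ S r = rankMonomial q t S r * forestEnum q t (S.card - 1) := by
  induction hN : S.card using Nat.strong_induction_on generalizing S r with
  | _ N ih =>
  subst hN
  by_cases hS : S.erase r = ∅
  · have : S = {r} := by
      rw [← Finset.insert_erase hr, hS]; rfl
    rw [this, weightSum_singleton, rankMonomial_singleton]
    simp [forestEnum]
  · obtain ⟨m, hmS⟩ := Finset.nonempty_iff_ne_empty.2 hS
    obtain ⟨hmr, hm⟩ := Finset.mem_erase.1 hmS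
    have hcard : (S.erase r).card = S.card - 1 := Finset.card_erase_of_mem hr
    have hpos : 0 < (S.erase r).card := Finset.card_pos.2 ⟨m, hmS⟩
    rw [weightSum_eq φ hr hm hmr]
    -- By induction the monomials of `B` and `S \ B` at `r` multiply to that of `S`, so what remains
    -- of the summand depends on |B| only.
    have step : ∀ B ∈ (S.erase r).powerset.filter (m ∈ ·),
        (∑ c ∈ B, φ r B c * weightSum φ B c) * weightSum φ (S \ B) r =
        rankMonomial q t S r * (fun k => qtInt q t k * forestEnum q t (k - 1) *
          forestEnum q t (S.card - 1 - k)) B.card := by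
      intro B hB
      rw [Finset.mem_filter, Finset.mem_powerset] at hB
      obtain ⟨hBS', hmB⟩ := hB
      have hBS : B ⊆ S := hBS'.trans (Finset.erase_subset _ _)
      have hrB : r ∉ B := fun h => (Finset.mem_erase.1 (hBS' h)).1 rfl
      have hc1 : B.card < S.card := Finset.card_lt_card ⟨hBS, fun h => hrB (h hr)⟩
      have hc2 : (S \ B).card = S.card - B.card := Finset.card_sdiff_of_subset hBS
      have hc3 : 0 < B.card := Finset.card_pos.2 ⟨m, hmB⟩
      have h1 : ∑ c ∈ B, φ r B c * weightSum φ B c =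
          rankMonomial q t B r * qtInt q t B.card * forestEnum q t (B.card - 1) := by
        rw [← hφ r B hrB, Finset.sum_mul]
        refine Finset.sum_congr rfl fun c hc => ?_
        rw [ih B.card hc1 B c hc rfl, mul_assoc]
      rw [h1, ih (S \ B).card (by omega) (S \ B) r (by simp [hr, hrB]) rfl]
      have h2 : rankMonomial q t S r = rankMonomial q t B r * rankMonomial q t (S \ B) r := by
        rw [← rankMonomial_union q t Finset.disjoint_sdiff, Finset.union_sdiff_of_subset hBS]
      rw [h2, show (S \ B).card - 1 = S.card - 1 - B.card by omega]
      ring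
    rw [Finset.sum_congr rfl step, ← Finset.mul_sum, sum_blocks _ m hmS (fun k => qtInt q t k * forestEnum q t (k - 1) *
          forestEnum q t (S.card - 1 - k)),
      Finset.sum_powerset_apply_card (fun k => qtInt q t (k + 1) * forestEnum q t (k + 1 - 1) *
          forestEnum q t (S.card - 1 - (k + 1)))]
    congr 1
    obtain ⟨k, hk⟩ : ∃ k, S.card - 1 = k + 1 := ⟨S.card - 2, by omega⟩
    rw [hk, forestEnum_succ, Finset.card_erase_of_mem hmS, hcard, hk]
    refine Finset.sum_congr rfl fun j hj => ?_
    simp [Nat.add_sub_add_right]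

theorem weightSum_vertexWeight_eq_rootWeight (S : Finset α) (r : α) (hr : r ∈ S) :
    weightSum (vertexWeight q t) S r = weightSum (rootWeight q t) S r := by
  rw [weightSum_eq_forestEnum q t _ (fun r B _ => sum_vertexWeight q t r B) S r hr,
    weightSum_eq_forestEnum q t _ (fun r B h => sum_rootWeight q t h) S r hr]

end Algebra

/-- Recursion along a parent map. -/
theorem exists_recursion {α β : Type*} {p : α → α} {r : α} (h : ∀ x, Below p r x)
    (a : β) (g : α → β → β) : ∃ F : α → β, F r = a ∧ ∀ x, x ≠ r → F x = g x (F (p x)) := by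
  classical
  have wf : WellFounded (fun y x => x ≠ r ∧ y = p x) := by
    refine ⟨fun x => ?_⟩
    induction h x with
    | refl => exact ⟨_, fun y hy => absurd rfl hy.1⟩
    | @step x _ ih =>
      refine ⟨_, ?_⟩
      rintro y ⟨_, rfl⟩
      exact ih
  refine ⟨wf.fix fun x ih => if hx : x = r then a else g x (ih (p x) ⟨hx, rfl⟩), ?_, ?_⟩
  · rw [wf.fix_eq, dif_pos rfl]
  · intro x hx
    rw [wf.fix_eq, dif_neg hx]

/-! ### Descendant pairs as a sum over edges -/

section Stats

variable {n : ℕ}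

/-- The parent maps of the trees on `[n]` rooted at `0`. -/
noncomputable def treeMaps (n : ℕ) : Finset (Fin (n + 1) → Fin (n + 1)) :=
  rootedTrees Finset.univ 0

theorem mem_treeMaps {P : Fin (n + 1) → Fin (n + 1)} :
    P ∈ treeMaps n ↔ P 0 = 0 ∧ ∀ x, Below P 0 x := by
  rw [treeMaps, mem_rootedTrees]
  exact ⟨fun h => ⟨h.root, fun x => h.reach x (Finset.mem_univ x)⟩,
    fun h => ⟨Finset.mem_univ _, h.1, fun _ _ => Finset.mem_univ _,
      fun x hx => absurd (Finset.mem_univ x) hx, fun x _ => h.2 x⟩⟩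

open Classical in
/-- The number of pairs `(i, j)` such that `j` is a strict descendant of `i`, related by `R`. -/
noncomputable def descPairs (P : Fin (n + 1) → Fin (n + 1))
    (R : Fin (n + 1) → Fin (n + 1) → Prop) : ℕ :=
  (Finset.univ.filter fun x : Fin (n + 1) × Fin (n + 1) =>
    (x.1 ≠ x.2 ∧ Below P x.1 x.2) ∧ R x.1 x.2).card

open Classical in
-- A pair (i, j) is charged to the unique child of `i` whose subtree contains `j`.
theorem descPairs_eq_sum {P : Fin (n + 1) → Fin (n + 1)} (hP : P ∈ treeMaps n)
    (R : Fin (n + 1) → Fin (n + 1) → Prop) :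
    descPairs P R = ∑ x ∈ Finset.univ.erase 0, ((sub P x).filter fun y => R (P x) y).card := by
  obtain ⟨h0, hb⟩ := mem_treeMaps.1 hP
  rw [descPairs, ← Finset.card_sigma]
  symm
  refine Finset.card_bij (fun x _ => (P x.1, x.2)) ?_ ?_ ?_
  · rintro ⟨x, y⟩ h
    simp only [Finset.mem_sigma, Finset.mem_erase, Finset.mem_filter, mem_sub,
      Finset.mem_univ, and_true, true_and] at h ⊢
    refine ⟨⟨?_, (below_parent P x).trans h.2.1⟩, h.2.2⟩
    intro hy
    exact not_below_parent h0 (hb x) h.1 (hy ▸ h.2.1)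
  · rintro ⟨x, y⟩ h ⟨x', y'⟩ h' he
    simp only [Finset.mem_sigma, Finset.mem_erase, Finset.mem_filter, mem_sub,
      Finset.mem_univ, and_true] at h h'
    simp only [Prod.mk.injEq] at he
    obtain ⟨he, rfl⟩ := he
    have := child_unique h0 (hb x) (hb x') h.1 h'.1 he h.2.1 h'.2.1
    subst this
    rfl
  · rintro ⟨x, y⟩ h
    simp only [Finset.mem_filter, Finset.mem_univ, true_and] at h
    obtain ⟨z, hz, rfl, hzy⟩ := h.1.2.exists_child h0 h.1.1
    refine ⟨⟨z, y⟩, ?_, rfl⟩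
    simp only [Finset.mem_sigma, Finset.mem_erase, Finset.mem_filter, mem_sub,
      Finset.mem_univ, and_true]
    exact ⟨hz, hzy, h.2⟩

theorem weight_vertexWeight {R : Type*} [CommRing R] (q t : R) {P : Fin (n + 1) → Fin (n + 1)}
    (hP : P ∈ treeMaps n) : weight (vertexWeight q t) Finset.univ 0 P =
      q ^ descPairs P (fun i j => j < i) * t ^ descPairs P (fun i j => i < j) := by
  classical
  rw [descPairs_eq_sum hP, descPairs_eq_sum hP, ← Finset.prod_pow_eq_pow_sum,
    ← Finset.prod_pow_eq_pow_sum, ← Finset.prod_mul_distrib, weight]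
  refine Finset.prod_congr rfl fun x _ => ?_
  rw [vertexWeight, rankMonomial]
  congr!

end Stats

/-! ### Parking functions and breadth-first order -/

section Parking

open BounceRef

variable {n : ℕ}

/-- The permutation sorting the labels along the Dyck path of `p`. -/
def labelSort (p : Fin n → ℕ) : Equiv.Perm (Fin n) :=
  Tuple.sort (fun c : Fin n => toLex (p c, OrderDual.toDual c))

theorem word_zero (p : Fin n → ℕ) : word p 0 = 0 := rfl

theorem word_succ (p : Fin n → ℕ) (i : Fin n) : word p i.succ = (labelSort p i).succ := rfl

theorem labelSort_lt (p : Fin n → ℕ) {i j : Fin n} (h : i < j) :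
    p (labelSort p i) < p (labelSort p j) ∨
      p (labelSort p i) = p (labelSort p j) ∧ labelSort p j < labelSort p i := by
  have h1 := Tuple.monotone_sort (fun c : Fin n => toLex (p c, OrderDual.toDual c)) h.le
  have h2 : toLex (p (labelSort p i), OrderDual.toDual (labelSort p i)) ≤
    toLex (p (labelSort p j), OrderDual.toDual (labelSort p j)) := h1
  rw [Prod.Lex.toLex_le_toLex] at h2
  refine h2.imp id fun h3 => ⟨h3.1, ?_⟩
  refine lt_of_le_of_ne h3.2 fun h4 => h.ne' ((labelSort p).injective h4)

theorem labelSort_comp (p : Fin n → ℕ) : p ∘ labelSort p = p ∘ Tuple.sort p := by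
  rw [Tuple.comp_sort_eq_comp_iff_monotone]
  intro i j hij
  rcases hij.eq_or_lt with rfl | hij
  · exact le_rfl
  · rcases labelSort_lt p hij with h | h
    · exact h.le
    · exact h.1.le

theorem isParkingFunction_iff (p : Fin n → ℕ) :
    IsParkingFunction p ↔ ∀ i : Fin n, p (labelSort p i) ≤ i := by
  have : ∀ i, p (labelSort p i) = p (Tuple.sort p i) := fun i => congrFun (labelSort_comp p) i
  simp only [this, IsParkingFunction]

theorem word_bijective (p : Fin n → ℕ) : Function.Bijective (word p) := by
  rw [← Finite.injective_iff_bijective]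
  intro i j h
  induction i using Fin.cases with
  | zero =>
    induction j using Fin.cases with
    | zero => rfl
    | succ j => rw [word_zero, word_succ] at h; exact absurd h.symm (Fin.succ_ne_zero _)
  | succ i =>
    induction j using Fin.cases with
    | zero => rw [word_zero, word_succ] at h; exact absurd h (Fin.succ_ne_zero _)
    | succ j =>
      rw [word_succ, word_succ] at h
      rw [(labelSort p).injective (Fin.succ_injective _ h)]

/-- The word of `p` as a permutation. -/
noncomputable def wordPerm (p : Fin n → ℕ) : Equiv.Perm (Fin (n + 1)) :=
  Equiv.ofBijective (word p) (word_bijective p)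

/-- The breadth-first tree of `p`: the labels at height `i` are the children of `wᵢ`. -/
def parkingParent (p : Fin n → ℕ) : Fin (n + 1) → Fin (n + 1) :=
  Fin.cases 0 fun c => word p (Fin.ofNat (n + 1) (p c))

theorem parkingParent_succ (p : Fin n → ℕ) (c : Fin n) :
    parkingParent p c.succ = word p (Fin.ofNat (n + 1) (p c)) := rfl

section

variable {p : Fin n → ℕ} (hp : IsParkingFunction p)

include hp

theorem parking_lt (c : Fin n) : p c < n := by
  have h := (isParkingFunction_iff p).1 hp ((labelSort p).symm c)
  rw [Equiv.apply_symm_apply] at h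
  omega

/-- The reduction modulo n + 1 in `Fin.ofNat` is harmless, since the entries of a parking function
are smaller than n. -/
theorem val_ofNat_parking (c : Fin n) : (Fin.ofNat (n + 1) (p c)).val = p c := by
  have := parking_lt hp c
  rw [Fin.val_ofNat, Nat.mod_eq_of_lt (by omega)]

/-- This is the parking condition read along the word: a parent occurs before its child. Hence
climbing ends at 0. -/
theorem position_parent_lt (i : Fin n) :
    ((wordPerm p).symm (parkingParent p (word p i.succ))).val < i.succ.val := by
  have h : (wordPerm p).symm (parkingParent p (word p i.succ)) =
      Fin.ofNat (n + 1) (p (labelSort p i)) := by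
    rw [Equiv.symm_apply_eq, word_succ, parkingParent_succ]
    rfl
  rw [h, val_ofNat_parking hp, Fin.val_succ]
  exact Nat.lt_succ_of_le ((isParkingFunction_iff p).1 hp i)

theorem parkingParent_mem : parkingParent p ∈ treeMaps n := by
  rw [mem_treeMaps]
  refine ⟨rfl, ?_⟩
  have : ∀ k : ℕ, ∀ i : Fin (n + 1), i.val = k → Below (parkingParent p) 0 (word p i) := by
    intro k
    induction k using Nat.strong_induction_on with
    | _ k ih =>
    intro i hi
    induction i using Fin.cases with
    | zero => exact .refl
    | succ i =>
      have h := position_parent_lt hp i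
      have h2 := ih _ (hi ▸ h) _ rfl
      refine .step ?_
      have h3 : word p ((wordPerm p).symm (parkingParent p (word p i.succ))) =
        parkingParent p (word p i.succ) := (wordPerm p).apply_symm_apply _
      rwa [h3] at h2
  intro x
  obtain ⟨i, rfl⟩ := (word_bijective p).2 x
  exact this _ i rfl

theorem mem_C_iff {v j : Fin (n + 1)} : j ∈ C p v ↔ j ≠ 0 ∧ parkingParent p j = v := by
  rw [C, Finset.mem_filter, and_iff_right (Finset.mem_univ _)]
  constructor
  · rintro ⟨i, rfl, c, rfl, hc⟩
    refine ⟨Fin.succ_ne_zero _, ?_⟩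
    rw [parkingParent_succ]
    congr 1
    ext
    rw [val_ofNat_parking hp, hc]
  · rintro ⟨hj, rfl⟩
    obtain ⟨c, rfl⟩ := Fin.exists_succ_eq.2 hj
    exact ⟨Fin.ofNat (n + 1) (p c), rfl, c, rfl, (val_ofNat_parking hp c).symm⟩

theorem memD_iff {v j : Fin (n + 1)} : MemD p v j ↔ v ≠ j ∧ Below (parkingParent p) v j := by
  obtain ⟨h0, hb⟩ := mem_treeMaps.1 (parkingParent_mem hp)
  constructor
  · intro h
    have : j ≠ 0 ∧ Below (parkingParent p) v (parkingParent p j) := by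
      induction h with
      | base h =>
        obtain ⟨h1, rfl⟩ := (mem_C_iff hp).1 h
        exact ⟨h1, .refl⟩
      | step h _ ih =>
        obtain ⟨h1, rfl⟩ := (mem_C_iff hp).1 h
        exact ⟨ih.1, (below_parent _ _).trans ih.2⟩
    refine ⟨?_, this.2.step⟩
    rintro rfl
    exact not_below_parent h0 (hb _) this.1 this.2
  · rintro ⟨hne, h⟩
    -- `MemD` lengthens a chain of children at its top, `Below` at its bottom.
    have snoc : ∀ {v k j}, MemD p v k → j ∈ C p k → MemD p v j := by
      intro v k j h hj
      induction h with
      | base h => exact .step h (.base hj)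
      | step h _ ih => exact .step h (ih hj)
    induction h with
    | refl => exact absurd rfl hne
    | @step j h ih =>
      have hj : j ≠ 0 := by
        rintro rfl
        exact hne (h.eq_of_fixed h0)
      have hjC : j ∈ C p (parkingParent p j) := (mem_C_iff hp).2 ⟨hj, rfl⟩
      by_cases hv : v = parkingParent p j
      · rw [← hv] at hjC; exact .base hjC
      · exact snoc (ih hv) hjC

open Classical in
theorem sum_card_D (R : Fin (n + 1) → Fin (n + 1) → Prop) :
    ∑ v, ((D p v).filter (R v)).card = descPairs (parkingParent p) R := by
  rw [descPairs, Finset.card_filter, Fintype.sum_prod_type]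
  refine Finset.sum_congr rfl fun v _ => ?_
  rw [D, Finset.filter_filter, Finset.card_filter]
  simp only [memD_iff hp]

theorem pinv_eq : pinv p = descPairs (parkingParent p) (fun i j => j < i) := by
  classical
  rw [← sum_card_D hp, pinv]
  refine Finset.sum_congr rfl fun v _ => ?_
  rw [binv]
  congr!

theorem copinv_eq : copinv p = descPairs (parkingParent p) (fun i j => i < j) := by
  classical
  rw [← sum_card_D hp, copinv]
  refine Finset.sum_congr rfl fun v _ => ?_
  rw [cobinv]
  congr!

end

/-- A numerical key whose order is the breadth-first order of the vertices of a tree. -/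
structure IsBreadthKey (P : Fin (n + 1) → Fin (n + 1)) (key : Fin (n + 1) → ℕ) : Prop where
  zero : key 0 = 1
  of_ne : ∀ x, x ≠ 0 → key x = (n + 1) * key (P x) + (n - x)

theorem exists_breadthKey {P : Fin (n + 1) → Fin (n + 1)} (hP : P ∈ treeMaps n) :
    ∃ key, IsBreadthKey P key := by
  obtain ⟨h0, hb⟩ := mem_treeMaps.1 hP
  obtain ⟨F, h1, h2⟩ := exists_recursion hb 1 (fun x k => (n + 1) * k + (n - x.val))
  exact ⟨F, h1, h2⟩

namespace IsBreadthKey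

variable {P : Fin (n + 1) → Fin (n + 1)} {key : Fin (n + 1) → ℕ} (hk : IsBreadthKey P key)

include hk

/-- For `x ≠ 0` the summand n - x of the key is a last digit in base n + 1. Keys therefore compare
parents before labels, and siblings come in decreasing order of labels, as in the word. -/
theorem lt_of {x y : Fin (n + 1)} (hx : x ≠ 0) (hy : y ≠ 0)
    (h : key (P x) < key (P y) ∨ key (P x) = key (P y) ∧ y < x) : key x < key y := by
  have hx0 : 0 < x.val := Nat.pos_of_ne_zero fun h => hx (Fin.ext h)
  rw [hk.of_ne x hx, hk.of_ne y hy]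
  rcases h with h | ⟨h, h'⟩
  · have : (n + 1) * (key (P x) + 1) ≤ (n + 1) * key (P y) := Nat.mul_le_mul_left _ h
    rw [mul_add] at this
    omega
  · rw [h]
    have := Fin.lt_def.1 h'
    omega

theorem parent_lt (hb : ∀ x, Below P 0 x) {x : Fin (n + 1)} (hx : x ≠ 0) :
    key (P x) < key x := by
  have pos : 0 < key (P x) := by
    generalize P x = y
    induction hb y with
    | refl => rw [hk.zero]; exact one_pos
    | @step y _ ih =>
      by_cases hy : y = 0
      · rw [hy, hk.zero]; exact one_pos
      · rw [hk.of_ne y hy]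
        positivity
  have hx0 : 0 < x.val := Nat.pos_of_ne_zero fun h => hx (Fin.ext h)
  rw [hk.of_ne x hx]
  have : 1 ≤ n := by omega
  nlinarith

theorem zero_lt (hb : ∀ x, Below P 0 x) {x : Fin (n + 1)} (hx : x ≠ 0) : key 0 < key x := by
  have : ∀ x, key 0 ≤ key x := by
    intro x
    induction hb x with
    | refl => exact le_rfl
    | @step y _ ih =>
      by_cases hy : y = 0
      · rw [hy]
      · exact ih.trans (hk.parent_lt hb hy).le
  exact (this _).trans_lt (hk.parent_lt hb hx)

theorem injective (hb : ∀ x, Below P 0 x) : Function.Injective key := by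
  intro x
  induction hb x with
  | refl =>
    intro y h
    by_contra hy
    exact (hk.zero_lt hb (Ne.symm hy)).ne h
  | @step x _ ih =>
    intro y h
    by_cases hx : x = 0
    · by_contra hy
      rw [hx] at h hy
      exact (hk.zero_lt hb (Ne.symm hy)).ne h
    by_cases hy : y = 0
    · rw [hy] at h
      exact absurd h (hk.zero_lt hb hx).ne'
    rcases lt_trichotomy (key (P x)) (key (P y)) with h1 | h1 | h1
    · exact absurd h (hk.lt_of hx hy (Or.inl h1)).ne
    · rcases lt_trichotomy x y with h2 | h2 | h2
      · exact absurd h (hk.lt_of hy hx (Or.inr ⟨h1.symm, h2⟩)).ne'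
      · exact h2
      · exact absurd h (hk.lt_of hx hy (Or.inr ⟨h1, h2⟩)).ne
    · exact absurd h (hk.lt_of hy hx (Or.inl h1)).ne'

omit hk in
-- A strictly increasing arrangement has no ties to break, so it coincides with the one chosen by
-- `Tuple.sort`.
theorem eq_sort {w : Equiv.Perm (Fin (n + 1))}
    (hw : ∀ i j, i < j → key (w i) < key (w j)) : w = Tuple.sort key := by
  rw [Tuple.eq_sort_iff]
  refine ⟨StrictMono.monotone hw, fun i j hij h => ?_⟩
  exact absurd h (hw i j hij).ne

end IsBreadthKey

/-- The word of a parking function lists the vertices of its tree in breadth-first order. -/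
theorem wordPerm_eq_sort {p : Fin n → ℕ} (hp : IsParkingFunction p) {key : Fin (n + 1) → ℕ}
    (hk : IsBreadthKey (parkingParent p) key) : wordPerm p = Tuple.sort key := by
  obtain ⟨h0, hb⟩ := mem_treeMaps.1 (parkingParent_mem hp)
  refine IsBreadthKey.eq_sort ?_
  -- Induction on the later position: when the heights differ, the comparison passes to the parents,
  -- which stand at positions given by the heights, and the later of these is still before `j`.
  have main : ∀ N : ℕ, ∀ i j : Fin (n + 1), j.val = N → i < j →
      key (word p i) < key (word p j) := by
    intro N
    induction N using Nat.strong_induction_on with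
    | _ N ih =>
    intro i j hj hij
    induction j using Fin.cases with
    | zero => exact absurd hij (Fin.not_lt_zero i)
    | succ j =>
      induction i using Fin.cases with
      | zero =>
        rw [word_zero, word_succ]
        exact hk.zero_lt hb (Fin.succ_ne_zero _)
      | succ i =>
        have hij' : i < j := Fin.succ_lt_succ_iff.1 hij
        refine hk.lt_of (Fin.succ_ne_zero _) (Fin.succ_ne_zero _) ?_
        rw [word_succ, word_succ, parkingParent_succ, parkingParent_succ]
        have hlt := (isParkingFunction_iff p).1 hp j
        rcases labelSort_lt p hij' with h | h
        · left
          refine ih _ ?_ _ _ rfl ?_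
          · rw [val_ofNat_parking hp, ← hj, Fin.val_succ]
            omega
          · change (Fin.ofNat (n + 1) (p (labelSort p i))).val <
              (Fin.ofNat (n + 1) (p (labelSort p j))).val
            rwa [val_ofNat_parking hp, val_ofNat_parking hp]
        · right
          rw [h.1]
          exact ⟨rfl, Fin.succ_lt_succ_iff.2 h.2⟩
  exact fun i j => main _ i j rfl

/-- The tree determines the keys, hence the word; then `p c` is the position in the word of the
parent of the label of `c`. -/
theorem parkingParent_injOn :
    Set.InjOn (parkingParent (n := n)) {p | IsParkingFunction p} := by
  intro p hp p' hp' h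
  obtain ⟨key, hk⟩ := exists_breadthKey (parkingParent_mem hp)
  have e : wordPerm p = wordPerm p' := by
    rw [wordPerm_eq_sort hp hk, wordPerm_eq_sort hp' (h ▸ hk)]
  funext c
  have h1 : wordPerm p (Fin.ofNat (n + 1) (p c)) = wordPerm p' (Fin.ofNat (n + 1) (p' c)) :=
    congrFun h c.succ
  rw [e] at h1
  have h2 := congrArg Fin.val ((wordPerm p').injective h1)
  rwa [val_ofNat_parking hp, val_ofNat_parking hp'] at h2

theorem exists_parkingParent_eq {P : Fin (n + 1) → Fin (n + 1)} (hP : P ∈ treeMaps n) :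
    ∃ p, IsParkingFunction p ∧ parkingParent p = P := by
  obtain ⟨h0, hb⟩ := mem_treeMaps.1 hP
  obtain ⟨key, hk⟩ := exists_breadthKey hP
  set σ := Tuple.sort key with hσ
  have hmono : ∀ i j, i < j → key (σ i) < key (σ j) := by
    intro i j hij
    refine lt_of_le_of_ne (Tuple.monotone_sort key hij.le) fun h => hij.ne ?_
    exact σ.injective (hk.injective hb h)
  have hmono' : ∀ x y, key x < key y ↔ σ.symm x < σ.symm y := by
    intro x y
    constructor
    · intro h
      by_contra h'
      rcases (not_lt.1 h').eq_or_lt with h2 | h2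
      · rw [σ.symm.injective h2] at h; exact lt_irrefl _ h
      · have := hmono _ _ h2
        rw [σ.apply_symm_apply, σ.apply_symm_apply] at this
        exact this.not_gt h
    · intro h
      have := hmono _ _ h
      rwa [σ.apply_symm_apply, σ.apply_symm_apply] at this
  -- The only possible preimage: the entry at `c` is the breadth-first position of the parent.
  set p : Fin n → ℕ := fun c => (σ.symm (P c.succ)).val with hpdef
  have hw : wordPerm p = σ := by
    refine IsBreadthKey.eq_sort fun i j hij => ?_
    change key (word p i) < key (word p j)
    induction j using Fin.cases with
    | zero => exact absurd hij (Fin.not_lt_zero i)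
    | succ j =>
      induction i using Fin.cases with
      | zero =>
        rw [word_zero, word_succ]
        exact hk.zero_lt hb (Fin.succ_ne_zero _)
      | succ i =>
        have hij' : i < j := Fin.succ_lt_succ_iff.1 hij
        refine hk.lt_of (Fin.succ_ne_zero _) (Fin.succ_ne_zero _) ?_
        rcases labelSort_lt p hij' with h | h
        · exact Or.inl ((hmono' _ _).2 h)
        · refine Or.inr ⟨?_, Fin.succ_lt_succ_iff.2 h.2⟩
          exact congrArg key (σ.symm.injective (Fin.ext h.1))
  have hp : IsParkingFunction p := by
    rw [isParkingFunction_iff]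
    intro i
    have h1 : (labelSort p i).succ = σ i.succ := by
      rw [← hw]; rfl
    have h2 : key (P (σ i.succ)) < key (σ i.succ) := by
      refine hk.parent_lt hb ?_
      rw [← h1]
      exact Fin.succ_ne_zero _
    rw [hmono', σ.symm_apply_apply, ← h1, Fin.lt_def, Fin.val_succ] at h2
    exact Nat.lt_succ_iff.1 h2
  refine ⟨p, hp, ?_⟩
  funext x
  induction x using Fin.cases with
  | zero => exact h0.symm
  | succ c =>
    have : Fin.ofNat (n + 1) (p c) = σ.symm (P c.succ) := by
      ext
      rw [val_ofNat_parking hp]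
    change wordPerm p (Fin.ofNat (n + 1) (p c)) = P c.succ
    rw [this, hw, σ.apply_symm_apply]

theorem parkPoly_eq : parkPoly n = weightSum (vertexWeight q t) Finset.univ (0 : Fin (n + 1)) := by
  rw [parkPoly, weightSum]
  refine Finset.sum_bij (fun p _ => parkingParent p) ?_ ?_ ?_ ?_
  · intro p hp
    exact parkingParent_mem ((mem_parkingFunctions p).1 hp)
  · intro p hp p' hp' h
    exact parkingParent_injOn ((mem_parkingFunctions p).1 hp) ((mem_parkingFunctions p').1 hp') h
  · intro P hP
    obtain ⟨p, hp, rfl⟩ := exists_parkingParent_eq hP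
    exact ⟨p, (mem_parkingFunctions p).2 hp, rfl⟩
  · intro p hp
    have hp' := (mem_parkingFunctions p).1 hp
    rw [weight_vertexWeight q t (parkingParent_mem hp'), pinv_eq hp', copinv_eq hp']

end Parking

/-! ### Trees as graphs and as parent maps -/

section Graph

open BounceRef

variable {n : ℕ}

theorem isTree_of_edgeSet_subset {G : SimpleGraph (Fin (n + 1))} (hG : G.Connected)
    (e : Fin n → Sym2 (Fin (n + 1))) (h : G.edgeSet ⊆ Set.range e) : G.IsTree := by
  classical
  rw [SimpleGraph.isTree_iff_connected_and_card]
  refine ⟨hG, le_antisymm ?_ hG.card_vert_le_card_edgeSet_add_one⟩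
  have h1 : Nat.card G.edgeSet ≤ n := by
    rw [Nat.card_coe_set_eq]
    refine (Set.ncard_le_ncard h (Set.finite_range e)).trans ?_
    rw [← Nat.card_coe_set_eq]
    exact (Finite.card_range_le e).trans (by simp)
  simpa using h1

/-- The graph with an edge from each vertex to its parent. -/
def parentGraph (P : Fin (n + 1) → Fin (n + 1)) : SimpleGraph (Fin (n + 1)) :=
  SimpleGraph.fromRel fun x y => P x = y

theorem parentGraph_adj {P : Fin (n + 1) → Fin (n + 1)} (hP : P ∈ treeMaps n) {x : Fin (n + 1)}
    (hx : x ≠ 0) : (parentGraph P).Adj x (P x) := by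
  obtain ⟨h0, hb⟩ := mem_treeMaps.1 hP
  rw [parentGraph, SimpleGraph.fromRel_adj]
  refine ⟨fun h => ?_, Or.inl rfl⟩
  refine not_below_parent h0 (hb x) hx ?_
  rw [← h]
  exact .refl

theorem exists_parentGraph_path {P : Fin (n + 1) → Fin (n + 1)} (hP : P ∈ treeMaps n)
    (j : Fin (n + 1)) : ∃ w : (parentGraph P).Walk j 0, w.IsPath ∧
      ∀ i, i ∈ w.support ↔ Below P i j := by
  obtain ⟨h0, hb⟩ := mem_treeMaps.1 hP
  have base : ∃ w : (parentGraph P).Walk 0 0, w.IsPath ∧ ∀ i, i ∈ w.support ↔ Below P i 0 := by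
    refine ⟨.nil, .nil, fun i => ?_⟩
    rw [SimpleGraph.Walk.support_nil, List.mem_singleton]
    exact ⟨fun h => h ▸ .refl, fun h => h.eq_of_fixed h0⟩
  induction hb j with
  | refl => exact base
  | @step j _ ih =>
    by_cases hj : j = 0
    · rw [hj]; exact base
    · obtain ⟨w, hw, hs⟩ := ih
      refine ⟨.cons (parentGraph_adj hP hj) w, ?_, fun i => ?_⟩
      · rw [SimpleGraph.Walk.cons_isPath_iff, hs]
        exact ⟨hw, not_below_parent h0 (hb j) hj⟩
      · rw [SimpleGraph.Walk.support_cons, List.mem_cons, hs, below_iff (y := j)]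

theorem parentGraph_isTree {P : Fin (n + 1) → Fin (n + 1)} (hP : P ∈ treeMaps n) :
    (parentGraph P).IsTree := by
  obtain ⟨h0, _⟩ := mem_treeMaps.1 hP
  refine isTree_of_edgeSet_subset ?_ (fun c => s(c.succ, P c.succ)) ?_
  · have h : ∀ x, (parentGraph P).Reachable x 0 := fun x =>
      ⟨(exists_parentGraph_path hP x).choose⟩
    exact (SimpleGraph.connected_iff _).2 ⟨fun x y => (h x).trans (h y).symm, ⟨0⟩⟩
  · intro e
    induction e with
    | _ x y =>
    rw [SimpleGraph.mem_edgeSet, parentGraph, SimpleGraph.fromRel_adj]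
    have key : ∀ x y : Fin (n + 1), x ≠ y → P x = y →
        s(x, y) ∈ Set.range fun c : Fin n => s(c.succ, P c.succ) := by
      rintro x y hxy rfl
      have hx : x ≠ 0 := by rintro rfl; exact hxy h0.symm
      obtain ⟨c, rfl⟩ := Fin.exists_succ_eq.2 hx
      exact ⟨c, rfl⟩
    rintro ⟨hne, h | h⟩
    · exact key x y hne h
    · rw [Sym2.eq_swap]; exact key y x hne.symm h

theorem isDescendant_parentGraph {P : Fin (n + 1) → Fin (n + 1)} (hP : P ∈ treeMaps n)
    {i j : Fin (n + 1)} : IsDescendant (parentGraph P) i j ↔ i ≠ j ∧ Below P i j := by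
  obtain ⟨w, hw, hs⟩ := exists_parentGraph_path hP j
  rw [IsDescendant]
  refine and_congr_right fun _ => ⟨?_, fun h => ⟨w, hw, (hs i).2 h⟩⟩
  rintro ⟨w', hw', hi⟩
  rw [((parentGraph_isTree hP).existsUnique_path j 0).unique hw' hw] at hi
  exact (hs i).1 hi

/-- The graph determines the descendants through its paths to 0, and these determine the parent map.
-/
theorem parentGraph_injOn : Set.InjOn (parentGraph (n := n)) {P | P ∈ treeMaps n} := by
  intro P hP P' hP' h
  obtain ⟨h0, hb⟩ := mem_treeMaps.1 hP
  obtain ⟨h0', hb'⟩ := mem_treeMaps.1 hP'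
  refine eq_of_below_iff h0 h0' hb hb' fun x y => ?_
  by_cases hxy : x = y
  · subst hxy; exact ⟨fun _ => .refl, fun _ => .refl⟩
  · have h1 := isDescendant_parentGraph hP (i := x) (j := y)
    rw [h, isDescendant_parentGraph hP'] at h1
    simpa [hxy] using h1.symm

theorem exists_parentGraph_eq {T : SimpleGraph (Fin (n + 1))} (hT : T.IsTree) :
    ∃ P ∈ treeMaps n, parentGraph P = T := by
  -- The parent of `x` is the second vertex of its path to 0; for `x = 0` the path is `nil`, whose
  -- `snd` is again 0.
  choose w hw hu using fun x => hT.existsUnique_path x 0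
  have h0 : (w 0).snd = 0 := by
    rw [← hu 0 .nil .nil]
    rfl
  have hadj : ∀ x, x ≠ 0 → T.Adj x (w x).snd := fun x hx =>
    (w x).adj_snd (SimpleGraph.Walk.not_nil_of_ne hx)
  have hb : ∀ {x y : Fin (n + 1)} (v : T.Walk x y), y = 0 → v.IsPath →
      Below (fun x => (w x).snd) 0 x := by
    intro x y v
    induction v with
    | nil => rintro rfl _; exact .refl
    | @cons x z y h v ih =>
      rintro rfl hv
      refine .step ?_
      have : (w x).snd = z := by
        rw [← hu x _ hv]
        simp
      simp only [this]
      exact ih rfl hv.of_cons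
  have hP : (fun x => (w x).snd) ∈ treeMaps n :=
    mem_treeMaps.2 ⟨h0, fun x => hb (w x) rfl (hw x)⟩
  refine ⟨_, hP, ?_⟩
  have hle : parentGraph (fun x => (w x).snd) ≤ T := by
    intro x y h
    rw [parentGraph, SimpleGraph.fromRel_adj] at h
    obtain ⟨hne, h | h⟩ := h
    · have hx : x ≠ 0 := by rintro rfl; exact hne (h0.symm.trans h)
      exact h ▸ hadj x hx
    · have hy : y ≠ 0 := by rintro rfl; exact hne (h.symm.trans h0)
      exact (h ▸ hadj y hy).symm
  -- A connected spanning subgraph of a tree is the whole tree.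
  exact le_antisymm hle
    ((SimpleGraph.isTree_iff_minimal_connected.1 hT).2 (parentGraph_isTree hP).connected hle)

theorem mem_trees {T : SimpleGraph (Fin (n + 1))} : T ∈ trees n ↔ T.IsTree := by simp [trees]

theorem card_trees : (trees n).card = (treeMaps n).card := by
  symm
  refine Finset.card_bij (fun P _ => parentGraph P) ?_ ?_ ?_
  · exact fun P hP => mem_trees.2 (parentGraph_isTree hP)
  · exact fun P hP P' hP' h => parentGraph_injOn hP hP' h
  · intro T hT
    obtain ⟨P, hP, rfl⟩ := exists_parentGraph_eq (mem_trees.1 hT)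
    exact ⟨P, hP, rfl⟩

theorem treePoly_eq : treePoly n = weightSum (vertexWeight q t) Finset.univ (0 : Fin (n + 1)) := by
  classical
  rw [treePoly, weightSum]
  symm
  refine Finset.sum_bij (fun P _ => parentGraph P) ?_ ?_ ?_ ?_
  · exact fun P hP => mem_trees.2 (parentGraph_isTree hP)
  · exact fun P hP P' hP' h => parentGraph_injOn hP hP' h
  · intro T hT
    obtain ⟨P, hP, rfl⟩ := exists_parentGraph_eq (mem_trees.1 hT)
    exact ⟨P, hP, rfl⟩
  · intro P hP
    rw [weight_vertexWeight q t hP]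
    simp only [inv, coinv, descPairs, isDescendant_parentGraph hP]

end Graph

/-! ### Inorder layouts, their intervals and moving tokens -/

section Layout

variable {n : ℕ}

/-- The number of vertices of the subtree at `x`, as an integer. -/
noncomputable def size (P : Fin (n + 1) → Fin (n + 1)) (x : Fin (n + 1)) : ℤ := (sub P x).card

/-- The total size of the branches at `v` whose roots lie in `[a, b)`. -/
noncomputable def branchSum (P : Fin (n + 1) → Fin (n + 1)) (v : Fin (n + 1)) (a b : ℕ) : ℤ :=
  ∑ c ∈ Finset.univ.filter (fun c : Fin (n + 1) => (c ≠ 0 ∧ P c = v) ∧ a ≤ c.val ∧ c.val < b),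
    size P c

/-- The distance from the left end of the interval of `P x` to the left end of that of `x`. -/
noncomputable def shift (P : Fin (n + 1) → Fin (n + 1)) (x : Fin (n + 1)) : ℤ :=
  if x < P x then branchSum P (P x) (x + 1) (P x)
  else branchSum P (P x) 0 (P x) + 1 + branchSum P (P x) (x + 1) (n + 1)

/-- The left ends of the intervals in the inorder layout of a tree: the subtree at `x ≠ 0` occupies
the interval of length `size P x` which starts at `A x`; the branches at `x` are arranged by
decreasing roots, those with smaller root than `x` to the left of `x`, the others to its right. -/
structure IsLayout (P : Fin (n + 1) → Fin (n + 1)) (A : Fin (n + 1) → ℤ) : Prop where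
  mem : P ∈ treeMaps n
  zero : A 0 = -1
  of_ne : ∀ x, x ≠ 0 → A x = A (P x) + shift P x

theorem exists_layout {P : Fin (n + 1) → Fin (n + 1)} (hP : P ∈ treeMaps n) :
    ∃ A, IsLayout P A := by
  obtain ⟨F, h1, h2⟩ := exists_recursion (mem_treeMaps.1 hP).2 (-1 : ℤ) (fun x k => k + shift P x)
  exact ⟨F, hP, h1, h2⟩

section BranchSum

variable (P : Fin (n + 1) → Fin (n + 1)) (v : Fin (n + 1))

theorem size_pos : 1 ≤ size P v := by
  have : 0 < (sub P v).card := Finset.card_pos.2 ⟨v, mem_sub.2 .refl⟩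
  unfold size
  omega

theorem branchSum_nonneg (a b : ℕ) : 0 ≤ branchSum P v a b :=
  Finset.sum_nonneg fun x _ => by have := size_pos P x; omega

theorem branchSum_add {a b c : ℕ} (hab : a ≤ b) (hbc : b ≤ c) :
    branchSum P v a b + branchSum P v b c = branchSum P v a c := by
  unfold branchSum
  rw [← Finset.sum_union]
  · congr 1
    ext x
    simp only [Finset.mem_union, Finset.mem_filter, Finset.mem_univ, true_and]
    constructor
    · rintro (h | h)
      · exact ⟨h.1, h.2.1, by omega⟩
      · exact ⟨h.1, by omega, h.2.2⟩
    · intro h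
      by_cases hx : x.val < b
      · exact Or.inl ⟨h.1, h.2.1, hx⟩
      · exact Or.inr ⟨h.1, by omega, h.2.2⟩
  · rw [Finset.disjoint_left]
    intro x hx hx'
    simp only [Finset.mem_filter, Finset.mem_univ, true_and] at hx hx'
    omega

theorem branchSum_of_le {a b : ℕ} (h : b ≤ a) : branchSum P v a b = 0 := by
  unfold branchSum
  rw [Finset.filter_false_of_mem, Finset.sum_empty]
  intro x _ hx
  omega

theorem branchSum_single (x : Fin (n + 1)) (hx : x ≠ 0) :
    branchSum P (P x) x (x + 1) = size P x := by
  unfold branchSum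
  rw [show Finset.univ.filter (fun c : Fin (n + 1) => (c ≠ 0 ∧ P c = P x) ∧
    x.val ≤ c.val ∧ c.val < x.val + 1) = {x} from ?_, Finset.sum_singleton]
  ext c
  simp only [Finset.mem_filter, Finset.mem_univ, true_and, Finset.mem_singleton]
  constructor
  · rintro ⟨_, h1, h2⟩
    exact Fin.ext (by omega)
  · rintro rfl
    exact ⟨⟨hx, rfl⟩, le_rfl, Nat.lt_succ_self _⟩

theorem branchSum_single_eq_zero (k : ℕ) (h : ∀ x : Fin (n + 1), x ≠ 0 → P x = v → x.val ≠ k) :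
    branchSum P v k (k + 1) = 0 := by
  unfold branchSum
  rw [Finset.filter_false_of_mem, Finset.sum_empty]
  rintro x _ ⟨⟨h1, h2⟩, h3, h4⟩
  exact h x h1 h2 (by omega)

end BranchSum

section TreeMaps

variable {P : Fin (n + 1) → Fin (n + 1)} (hP : P ∈ treeMaps n)

include hP

theorem parent_ne {x : Fin (n + 1)} (hx : x ≠ 0) : P x ≠ x := by
  obtain ⟨h0, hb⟩ := mem_treeMaps.1 hP
  intro h
  refine not_below_parent h0 (hb x) hx ?_
  rw [h]
  exact .refl

theorem size_eq (v : Fin (n + 1)) : size P v = 1 + branchSum P v 0 (n + 1) := by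
  classical
  obtain ⟨h0, hb⟩ := mem_treeMaps.1 hP
  have h : sub P v = insert v ((Finset.univ.filter (fun c : Fin (n + 1) =>
      (c ≠ 0 ∧ P c = v) ∧ 0 ≤ c.val ∧ c.val < n + 1)).biUnion (sub P)) := by
    ext y
    simp only [mem_sub, Finset.mem_insert, Finset.mem_biUnion, Finset.mem_filter,
      Finset.mem_univ, true_and]
    constructor
    · intro h
      by_cases hy : v = y
      · exact Or.inl hy.symm
      · obtain ⟨z, hz, hzv, hzy⟩ := h.exists_child h0 hy
        exact Or.inr ⟨z, ⟨⟨hz, hzv⟩, Nat.zero_le _, z.2⟩, hzy⟩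
    · rintro (rfl | ⟨z, ⟨⟨_, rfl⟩, _⟩, hz⟩)
      · exact .refl
      · exact (below_parent P z).trans hz
  have hv : v ∉ (Finset.univ.filter (fun c : Fin (n + 1) =>
      (c ≠ 0 ∧ P c = v) ∧ 0 ≤ c.val ∧ c.val < n + 1)).biUnion (sub P) := by
    simp only [mem_sub, Finset.mem_biUnion, Finset.mem_filter, Finset.mem_univ, true_and]
    rintro ⟨z, ⟨⟨hz, rfl⟩, _⟩, hzy⟩
    exact not_below_parent h0 (hb z) hz hzy
  rw [size, h, Finset.card_insert_of_notMem hv, Finset.card_biUnion, branchSum]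
  · push_cast
    rw [add_comm]
    rfl
  · intro x hx y hy hxy
    simp only [Finset.coe_filter, Set.mem_ofPred_eq, Finset.mem_univ, true_and] at hx hy
    rw [Function.onFun, Finset.disjoint_left]
    intro z hz hz'
    rw [mem_sub] at hz hz'
    exact hxy (child_unique h0 (hb x) (hb y) hx.1.1 hy.1.1 (hx.1.2.trans hy.1.2.symm) hz hz')

theorem size_zero : size P 0 = n + 1 := by
  have : sub P 0 = Finset.univ := by
    ext y
    simp [(mem_treeMaps.1 hP).2 y]
  rw [size, this, Finset.card_univ, Fintype.card_fin]
  push_cast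
  ring

theorem size_eq' (v : Fin (n + 1)) :
    size P v = branchSum P v 0 v + 1 + branchSum P v (v + 1) (n + 1) := by
  have hv := v.2
  rw [size_eq hP, ← branchSum_add P v (Nat.zero_le v.val) hv.le,
    ← branchSum_add P v (Nat.le_succ v.val) hv, branchSum_single_eq_zero P v v.val]
  · ring
  · intro x hx hxv h
    obtain rfl := Fin.ext h
    exact parent_ne hP hx hxv

end TreeMaps

/-- The position, after the first `k - 1` factors, of the token which starts at the place of `v`
in the inorder layout. -/
noncomputable def token (P : Fin (n + 1) → Fin (n + 1)) (A : Fin (n + 1) → ℤ) (k : ℕ)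
    (v : Fin (n + 1)) : ℤ :=
  if v.val < k then A v + branchSum P v 0 v + 1 + branchSum P v k (n + 1)
  else A v + branchSum P v k v

namespace IsLayout

variable {P : Fin (n + 1) → Fin (n + 1)} {A : Fin (n + 1) → ℤ} (hA : IsLayout P A)

include hA

theorem of_lt {x : Fin (n + 1)} (hx : x ≠ 0) (h : x < P x) :
    A x = A (P x) + branchSum P (P x) (x + 1) (P x) ∧
      A x + size P x = A (P x) + branchSum P (P x) x (P x) := by
  have h1 := hA.of_ne x hx
  rw [shift, if_pos h] at h1
  refine ⟨h1, ?_⟩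
  rw [h1, ← branchSum_add P (P x) (Nat.le_succ x.val) h, branchSum_single P x hx]
  ring

theorem of_gt {x : Fin (n + 1)} (hx : x ≠ 0) (h : P x < x) :
    A x = A (P x) + branchSum P (P x) 0 (P x) + 1 + branchSum P (P x) (x + 1) (n + 1) ∧
      A x + size P x = A (P x) + branchSum P (P x) 0 (P x) + 1 +
        branchSum P (P x) x (n + 1) := by
  have h1 := hA.of_ne x hx
  rw [shift, if_neg h.not_gt] at h1
  refine ⟨by rw [h1]; ring, ?_⟩
  rw [h1, ← branchSum_add P (P x) (Nat.le_succ x.val) x.2, branchSum_single P x hx]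
  ring

theorem lt_or_gt {x : Fin (n + 1)} (hx : x ≠ 0) : x < P x ∨ P x < x :=
  lt_or_gt_of_ne (parent_ne hA.mem hx).symm

theorem bounds_of_lt {x : Fin (n + 1)} (hx : x ≠ 0) (h : x < P x) :
    A (P x) ≤ A x ∧ A x + size P x ≤ A (P x) + branchSum P (P x) 0 (P x) := by
  obtain ⟨h1, h2⟩ := hA.of_lt hx h
  rw [h2, h1, ← branchSum_add P (P x) (Nat.zero_le x.val) (Fin.lt_def.1 h).le]
  have := branchSum_nonneg P (P x) (x + 1) (P x)
  have := branchSum_nonneg P (P x) 0 x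
  constructor <;> linarith

theorem bounds_of_gt {x : Fin (n + 1)} (hx : x ≠ 0) (h : P x < x) :
    A (P x) + branchSum P (P x) 0 (P x) + 1 ≤ A x ∧
      A x + size P x ≤ A (P x) + size P (P x) := by
  obtain ⟨h1, h2⟩ := hA.of_gt hx h
  rw [h2, h1, size_eq' hA.mem (P x), ← branchSum_add P (P x) (Fin.lt_def.1 h) x.2.le]
  have := branchSum_nonneg P (P x) (x + 1) (n + 1)
  have := branchSum_nonneg P (P x) (P x + 1) x
  constructor <;> linarith

theorem bounds_parent {x : Fin (n + 1)} (hx : x ≠ 0) :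
    A (P x) ≤ A x ∧ A x + size P x ≤ A (P x) + size P (P x) := by
  have h1 := size_eq' hA.mem (P x)
  have h2 := branchSum_nonneg P (P x) 0 (P x)
  have h3 := branchSum_nonneg P (P x) (P x + 1) (n + 1)
  rcases hA.lt_or_gt hx with h | h
  · have := hA.bounds_of_lt hx h
    constructor <;> linarith
  · have := hA.bounds_of_gt hx h
    constructor <;> linarith

theorem bounds_below {x y : Fin (n + 1)} (h : Below P x y) :
    A x ≤ A y ∧ A y + size P y ≤ A x + size P x := by
  obtain ⟨h0, _⟩ := mem_treeMaps.1 hA.mem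
  induction h with
  | refl => exact ⟨le_rfl, le_rfl⟩
  | @step y _ ih =>
    by_cases hy : y = 0
    · rwa [hy, h0, ← hy] at ih
    · have := hA.bounds_parent hy
      exact ⟨ih.1.trans this.1, this.2.trans ih.2⟩

/-- The root has no smaller child, so it sits at the left end -1 of its interval, and all other
intervals lie between 0 and -1 + (n + 1) = n. -/
theorem bounds_of_ne {x : Fin (n + 1)} (hx : x ≠ 0) : 0 ≤ A x ∧ A x + size P x ≤ n := by
  obtain ⟨h0, hb⟩ := mem_treeMaps.1 hA.mem
  obtain ⟨z, hz, hz0, hzx⟩ := (hb x).exists_child h0 (Ne.symm hx)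
  have h1 := hA.bounds_below hzx
  have h2 := hA.bounds_below (hb x)
  have h3 := hA.bounds_of_gt hz (by rw [hz0]; exact Fin.pos_of_ne_zero hz)
  rw [hz0, hA.zero] at h3
  rw [hA.zero, size_zero hA.mem] at h2
  have := branchSum_nonneg P 0 0 (0 : Fin (n + 1))
  constructor <;> linarith

/-- Either the parent separates the two branches, or they lie on the same side of it, the one with
the larger root further left. -/
theorem disjoint_siblings {x y : Fin (n + 1)} (hx : x ≠ 0) (hy : y ≠ 0) (h : P x = P y)
    (hxy : x ≠ y) : A x + size P x ≤ A y ∨ A y + size P y ≤ A x := by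
  wlog hlt : x < y generalizing x y
  · exact (this hy hx h.symm hxy.symm (lt_of_le_of_ne (not_lt.1 hlt) hxy.symm)).symm
  rcases hA.lt_or_gt hx with h1 | h1
  · rcases hA.lt_or_gt hy with h2 | h2
    · right
      rw [(hA.of_lt hx h1).1, (hA.of_lt hy h2).2, h,
        ← branchSum_add P (P y) (Fin.lt_def.1 hlt) (Fin.lt_def.1 h2).le]
      have := branchSum_nonneg P (P y) (x + 1) y
      linarith
    · left
      have h3 := (hA.bounds_of_lt hx h1).2
      have h4 := (hA.bounds_of_gt hy h2).1
      rw [h] at h3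
      linarith
  · right
    have h2 : P y < y := h ▸ h1.trans hlt
    rw [(hA.of_gt hx h1).1, (hA.of_gt hy h2).2, h,
      ← branchSum_add P (P y) (Fin.lt_def.1 hlt) y.2.le]
    have := branchSum_nonneg P (P y) (x + 1) y
    linarith

theorem disjoint_of_not_below {x y : Fin (n + 1)} (h1 : ¬ Below P x y) (h2 : ¬ Below P y x) :
    A x + size P x ≤ A y ∨ A y + size P y ≤ A x := by
  obtain ⟨h0, hb⟩ := mem_treeMaps.1 hA.mem
  induction hb x with
  | refl => exact absurd (hb y) h1
  | @step x _ ih =>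
    by_cases hx : x = 0
    · exact absurd (hx ▸ hb y) h1
    by_cases h3 : Below P (P x) y
    · obtain ⟨z, hz, hzx, hzy⟩ := h3.exists_child h0 (by
        rintro rfl
        exact h2 (below_parent P x))
      have h4 := hA.disjoint_siblings hx hz hzx.symm (by rintro rfl; exact h1 hzy)
      have h5 := hA.bounds_below hzy
      rcases h4 with h4 | h4
      · left; linarith
      · right; linarith
    · have h4 := ih h3 fun h => h2 h.step
      have h5 := hA.bounds_parent hx
      rcases h4 with h4 | h4
      · left; linarith
      · right; linarith

/-- The inorder position of `x` lies in the interval of `x`. -/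
theorem position_mem (x : Fin (n + 1)) :
    A x ≤ A x + branchSum P x 0 x ∧ A x + branchSum P x 0 x < A x + size P x := by
  have h1 := size_eq' hA.mem x
  have h2 := branchSum_nonneg P x 0 x
  have h3 := branchSum_nonneg P x (x + 1) (n + 1)
  constructor <;> linarith

/-- A vertex lies outside the intervals of its branches, and vertices unrelated in the tree have
disjoint intervals. -/
theorem position_injective : Function.Injective fun x => A x + branchSum P x 0 x := by
  obtain ⟨h0, hb⟩ := mem_treeMaps.1 hA.mem
  have key : ∀ x y, Below P x y → x ≠ y →
      A x + branchSum P x 0 x ≠ A y + branchSum P y 0 y := by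
    intro x y hxy hne
    obtain ⟨z, hz, rfl, hzy⟩ := hxy.exists_child h0 hne
    have h1 := hA.bounds_below hzy
    have h2 := hA.position_mem y
    rcases hA.lt_or_gt hz with h | h
    · have := hA.bounds_of_lt hz h
      intro h'
      linarith
    · have := hA.bounds_of_gt hz h
      intro h'
      linarith
  intro x y hxy
  by_contra hne
  simp only at hxy
  by_cases h1 : Below P x y
  · exact key x y h1 hne hxy
  by_cases h2 : Below P y x
  · exact key y x h2 (Ne.symm hne) hxy.symm
  have h3 := hA.position_mem x
  have h4 := hA.position_mem y
  rcases hA.disjoint_of_not_below h1 h2 with h | h <;> linarith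

/-- The token of `v ≠ 0` starts at the inorder position of `v` and jumps left over its smaller
branches, nearest one and hence smallest root first. At its own turn it is at the left end of the
interval of `v` and jumps to the right end. From there it jumps left over the larger branches, again
in increasing order of roots, and stops one place to the right of its start. -/
theorem token_self (x : Fin (n + 1)) : token P A x x = A x := by
  rw [token, if_neg (lt_irrefl _), branchSum_of_le P x le_rfl, add_zero]

theorem token_succ_self (x : Fin (n + 1)) : token P A (x + 1) x = A x + size P x := by
  rw [token, if_pos (Nat.lt_succ_self _), size_eq' hA.mem x]
  ring

/-- On either side the branches are crossed from right to left, so at the turn of `x` the token of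
the parent is at the right end of the interval of `x`. -/
theorem token_parent {x : Fin (n + 1)} (hx : x ≠ 0) : token P A x (P x) = A x + size P x := by
  rcases hA.lt_or_gt hx with h | h
  · rw [token, if_neg (by have := Fin.lt_def.1 h; omega), (hA.of_lt hx h).2]
  · rw [token, if_pos (Fin.lt_def.1 h), (hA.of_gt hx h).2]

theorem token_succ_parent {x : Fin (n + 1)} (hx : x ≠ 0) : token P A (x + 1) (P x) = A x := by
  rcases hA.lt_or_gt hx with h | h
  · rw [token, if_neg (by have := Fin.lt_def.1 h; omega), ← (hA.of_lt hx h).1]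
  · rw [token, if_pos (by have := Fin.lt_def.1 h; omega), ← (hA.of_gt hx h).1]

theorem token_succ_of_ne {x v : Fin (n + 1)} (h1 : v ≠ x) (h2 : v ≠ P x) :
    token P A (x + 1) v = token P A x v := by
  have h3 : branchSum P v x (x + 1) = 0 := by
    refine branchSum_single_eq_zero P v x fun y _ hyv hyx => ?_
    obtain rfl := Fin.ext hyx
    exact h2 hyv.symm
  have hne : v.val ≠ x.val := fun h => h1 (Fin.ext h)
  unfold token
  by_cases h : v.val < x.val
  · rw [if_pos h, if_pos (by omega), ← branchSum_add P v (Nat.le_succ x.val) x.2, h3, zero_add]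
  · rw [if_neg h, if_neg (by omega),
      ← branchSum_add P v (Nat.le_succ x.val) (show x.val + 1 ≤ v.val by omega), h3, zero_add]

/-- The initial tokens are at the inorder positions, except that of the root. -/
theorem token_one {x : Fin (n + 1)} (hx : x ≠ 0) : token P A 1 x = A x + branchSum P x 0 x := by
  have hx0 : 0 < x.val := Nat.pos_of_ne_zero fun h => hx (Fin.ext h)
  rw [token, if_neg (by omega), ← branchSum_add P x (Nat.zero_le 1) hx0,
    branchSum_single_eq_zero P x 0 fun y hy _ h => hy (Fin.ext h), zero_add]

/-- There is no factor for the root: its token counts as having already jumped to the right end of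
the whole interval. -/
theorem token_one_zero : token P A 1 0 = n := by
  have h1 := size_eq' hA.mem 0
  rw [size_zero hA.mem] at h1
  rw [token, if_pos (by simp), hA.zero]
  simp only [Fin.val_zero, zero_add] at h1 ⊢
  linarith

theorem token_last (x : Fin (n + 1)) : token P A (n + 1) x = A x + branchSum P x 0 x + 1 := by
  rw [token, if_pos x.2, branchSum_of_le P x le_rfl, add_zero]

theorem token_one_mem (x : Fin (n + 1)) : 0 ≤ token P A 1 x ∧ token P A 1 x ≤ n := by
  by_cases hx : x = 0
  · rw [hx, hA.token_one_zero]
    exact ⟨by positivity, le_rfl⟩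
  · rw [hA.token_one hx]
    have h1 := hA.bounds_of_ne hx
    have h2 := hA.position_mem x
    constructor <;> linarith

theorem token_one_injective : Function.Injective (token P A 1) := by
  have key : ∀ x : Fin (n + 1), x ≠ 0 → token P A 1 x ≠ token P A 1 0 := by
    intro x hx
    rw [hA.token_one hx, hA.token_one_zero]
    have h1 := hA.bounds_of_ne hx
    have h2 := hA.position_mem x
    exact ne_of_lt (by linarith)
  intro x y h
  by_cases hx : x = 0
  · by_contra hy
    rw [hx] at h hy
    exact key y (Ne.symm hy) h.symm
  · by_cases hy : y = 0
    · rw [hy] at h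
      exact absurd h (key x hx)
    · rw [hA.token_one hx, hA.token_one hy] at h
      exact hA.position_injective h

/-- The place at which the token of `x` starts. -/
theorem exists_start : ∃ s : Equiv.Perm (Fin (n + 1)), ∀ x, ((s x).val : ℤ) = token P A 1 x := by
  have h : ∀ x, ∃ y : Fin (n + 1), (y.val : ℤ) = token P A 1 x := by
    intro x
    obtain ⟨h1, h2⟩ := hA.token_one_mem x
    exact ⟨⟨(token P A 1 x).toNat, by omega⟩, by simp [h1]⟩
  choose s hs using h
  have hinj : Function.Injective s := by
    intro x y hxy
    refine hA.token_one_injective ?_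
    rw [← hs, ← hs, hxy]
  exact ⟨Equiv.ofBijective s (Finite.injective_iff_bijective.1 hinj), hs⟩

end IsLayout

end Layout

/-! ### Partial products -/

section Products

/-- Induction along the partial products of a sequence of permutations, first factor applied
first. -/
theorem reverse_prod_ofFn_induction {α : Type*} {m : ℕ} (g : Fin m → Equiv.Perm α)
    (M : ℕ → Equiv.Perm α → Prop) (h0 : M 0 1)
    (hs : ∀ (k : Fin m) (Q : Equiv.Perm α), M k Q → M (k + 1) (g k * Q)) :
    M m (List.ofFn g).reverse.prod := by
  induction m with
  | zero => simpa using h0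
  | succ m ih =>
    rw [List.ofFn_succ_last, List.reverse_append, List.reverse_singleton,
      List.singleton_append, List.prod_cons]
    exact hs (Fin.last m) _ (ih _ fun k Q h => hs k.castSucc Q h)

end Products

/-! ### The factorization attached to a layout, and its areas -/

section Layout

open BounceRef

variable {n : ℕ}

/-- The sequence of transpositions which exchange the ends of the intervals of a layout. -/
noncomputable def layoutFactors (P : Fin (n + 1) → Fin (n + 1)) (A : Fin (n + 1) → ℤ) :
    Fin n → Fin (n + 1) × Fin (n + 1) := fun k =>
  (Fin.ofNat (n + 1) (A k.succ).toNat, Fin.ofNat (n + 1) (A k.succ + size P k.succ).toNat)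

/-- The total size of the branches with a root smaller than its parent. -/
noncomputable def lowSum (P : Fin (n + 1) → Fin (n + 1)) : ℕ :=
  ∑ x ∈ Finset.univ.filter (fun x : Fin (n + 1) => x ≠ 0 ∧ x < P x), (sub P x).card

/-- The total size of the branches with a root larger than its parent. -/
noncomputable def highSum (P : Fin (n + 1) → Fin (n + 1)) : ℕ :=
  ∑ x ∈ Finset.univ.filter (fun x : Fin (n + 1) => x ≠ 0 ∧ P x < x), (sub P x).card

theorem branchSum_zero_zero (P : Fin (n + 1) → Fin (n + 1)) :
    branchSum P 0 0 (0 : Fin (n + 1)) = 0 :=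
  branchSum_of_le P 0 (by simp)

theorem lowSum_eq (P : Fin (n + 1) → Fin (n + 1)) :
    (lowSum P : ℤ) = ∑ v : Fin (n + 1), branchSum P v 0 v := by
  rw [lowSum, Nat.cast_sum, ← Finset.sum_fiberwise (g := P)]
  refine Finset.sum_congr rfl fun v _ => ?_
  rw [branchSum]
  refine Finset.sum_congr ?_ fun _ _ => rfl
  ext c
  simp only [Finset.mem_filter, Finset.mem_univ, true_and, Fin.lt_def]
  constructor
  · rintro ⟨⟨h1, h2⟩, rfl⟩
    exact ⟨⟨h1, rfl⟩, Nat.zero_le _, h2⟩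
  · rintro ⟨⟨h1, rfl⟩, _, h2⟩
    exact ⟨⟨h1, h2⟩, rfl⟩

theorem highSum_eq (P : Fin (n + 1) → Fin (n + 1)) :
    (highSum P : ℤ) = ∑ v : Fin (n + 1), branchSum P v (v + 1) (n + 1) := by
  rw [highSum, Nat.cast_sum, ← Finset.sum_fiberwise (g := P)]
  refine Finset.sum_congr rfl fun v _ => ?_
  rw [branchSum]
  refine Finset.sum_congr ?_ fun _ _ => rfl
  ext c
  simp only [Finset.mem_filter, Finset.mem_univ, true_and, Fin.lt_def]
  constructor
  · rintro ⟨⟨h1, h2⟩, rfl⟩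
    exact ⟨⟨h1, rfl⟩, h2, c.2⟩
  · rintro ⟨⟨h1, rfl⟩, h2, _⟩
    exact ⟨⟨h1, h2⟩, rfl⟩

theorem weight_rootWeight {R : Type*} [CommRing R] (q t : R) {P : Fin (n + 1) → Fin (n + 1)}
    (hP : P ∈ treeMaps n) :
    weight (rootWeight q t) Finset.univ 0 P = q ^ lowSum P * t ^ highSum P := by
  rw [weight, lowSum, highSum, ← Finset.prod_pow_eq_pow_sum, ← Finset.prod_pow_eq_pow_sum]
  unfold rootWeight
  rw [Finset.prod_ite]
  congr 1
  · refine Finset.prod_congr ?_ fun _ _ => rfl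
    ext x
    simp
  · refine Finset.prod_congr ?_ fun _ _ => rfl
    ext x
    simp only [Finset.mem_filter, Finset.mem_erase, Finset.mem_univ, and_true, true_and]
    refine and_congr_right fun hx => ?_
    rw [not_lt, le_iff_lt_or_eq, or_iff_left (parent_ne hP hx)]

namespace IsLayout

variable {P : Fin (n + 1) → Fin (n + 1)} {A : Fin (n + 1) → ℤ} (hA : IsLayout P A)

include hA

theorem layoutFactors_fst (k : Fin n) : (((layoutFactors P A k).1.val : ℕ) : ℤ) = A k.succ := by
  have h1 := hA.bounds_of_ne (Fin.succ_ne_zero k)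
  have h2 := size_pos P k.succ
  change ((((A k.succ).toNat % (n + 1) : ℕ)) : ℤ) = _
  rw [Nat.mod_eq_of_lt (by omega)]
  omega

theorem layoutFactors_snd (k : Fin n) :
    (((layoutFactors P A k).2.val : ℕ) : ℤ) = A k.succ + size P k.succ := by
  have h1 := hA.bounds_of_ne (Fin.succ_ne_zero k)
  have h2 := size_pos P k.succ
  change ((((A k.succ + size P k.succ).toNat % (n + 1) : ℕ)) : ℤ) = _
  rw [Nat.mod_eq_of_lt (by omega)]
  omega

theorem leftToRightProd_layoutFactors :
    leftToRightProd (layoutFactors P A) = finRotate (n + 1) := by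
  obtain ⟨s, hs⟩ := hA.exists_start
  -- Invariant: after k factors, every token is where `token` puts it just before the turn of the
  -- vertex k + 1.
  have main := reverse_prod_ofFn_induction
    (fun k => Equiv.swap (layoutFactors P A k).1 (layoutFactors P A k).2)
    (fun k Q => ∀ v, ((Q (s v)).val : ℤ) = token P A (k + 1) v)
    (fun v => by simpa using hs v) ?_
  · ext x
    obtain ⟨v, rfl⟩ := s.surjective x
    have h1 := main v
    rw [hA.token_last] at h1
    change ((leftToRightProd (layoutFactors P A)) (s v)).val = _
    change (((leftToRightProd (layoutFactors P A)) (s v)).val : ℤ) = _ at h1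
    -- The root token goes from n to -1 + 1 = 0, the wrap-around of the cycle; every other token
    -- advances by one.
    by_cases hv : v = 0
    · have h2 := hs v
      rw [hv, hA.token_one_zero] at h2
      have h3 : s v = Fin.last n := Fin.ext (by rw [hv, Fin.val_last]; omega)
      rw [hv, hA.zero, branchSum_zero_zero] at h1
      rw [h3, finRotate_last, Fin.val_zero, ← h3, hv]
      omega
    · have h2 := hs v
      rw [hA.token_one hv] at h2
      have h3 : s v ≠ Fin.last n := by
        intro h
        rw [h, Fin.val_last] at h2
        have h4 := hA.bounds_of_ne hv
        have h5 := hA.position_mem v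
        linarith
      rw [coe_finRotate_of_ne_last h3]
      omega
  · intro k Q hQ
    have hk : k.succ ≠ 0 := Fin.succ_ne_zero k
    have hkv : (k : ℕ) + 1 = k.succ.val := (Fin.val_succ k).symm
    simp only [hkv] at hQ ⊢
    have e1 : Q (s k.succ) = (layoutFactors P A k).1 := by
      refine Fin.ext ?_
      have h1 := hQ k.succ
      rw [hA.token_self, ← hA.layoutFactors_fst] at h1
      exact_mod_cast h1
    have e2 : Q (s (P k.succ)) = (layoutFactors P A k).2 := by
      refine Fin.ext ?_
      have h1 := hQ (P k.succ)
      rw [hA.token_parent hk, ← hA.layoutFactors_snd] at h1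
      exact_mod_cast h1
    intro v
    rw [Equiv.Perm.mul_apply]
    by_cases h1 : v = k.succ
    · rw [h1, e1, Equiv.swap_apply_left, hA.layoutFactors_snd, hA.token_succ_self]
    by_cases h2 : v = P k.succ
    · rw [h2, e2, Equiv.swap_apply_right, hA.layoutFactors_fst, hA.token_succ_parent hk]
    · rw [Equiv.swap_apply_of_ne_of_ne, hA.token_succ_of_ne h1 h2, hQ]
      · rw [← e1]
        exact fun h => h1 (s.injective (Q.injective h))
      · rw [← e2]
        exact fun h => h2 (s.injective (Q.injective h))

theorem layoutFactors_mem : layoutFactors P A ∈ factorizations n := by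
  rw [factorizations, Finset.mem_filter]
  refine ⟨Finset.mem_univ _, fun k => ?_, hA.leftToRightProd_layoutFactors⟩
  have h1 := hA.layoutFactors_fst k
  have h2 := hA.layoutFactors_snd k
  have h3 := size_pos P k.succ
  rw [Fin.lt_def]
  omega

/-- The starting places of the tokens are 0, …, n in some order, and the root takes n. -/
theorem sum_position :
    ∑ k : Fin n, (A k.succ + branchSum P k.succ 0 k.succ) = (n.choose 2 : ℤ) := by
  obtain ⟨s, hs⟩ := hA.exists_start
  have h1 : ∑ x : Fin (n + 1), ((s x).val : ℤ) = ((n + 1).choose 2 : ℤ) := by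
    rw [Equiv.sum_comp s (fun i : Fin (n + 1) => (i.val : ℤ)),
      Fin.sum_univ_eq_sum_range (fun i => (i : ℤ)), ← Nat.cast_sum, Finset.sum_range_id,
      Nat.choose_two_right]
  rw [Fin.sum_univ_succ, hs, hA.token_one_zero, Nat.choose_succ_succ' n 1, Nat.choose_one_right,
    Nat.cast_add] at h1
  have h2 := add_left_cancel h1
  rw [← h2]
  refine Finset.sum_congr rfl fun k _ => ?_
  rw [hs, hA.token_one (Fin.succ_ne_zero k)]

/-- The distance from the left end of the interval of `x` to its inorder position is the total size
of its smaller branches. -/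
theorem areaL_layoutFactors : areaL (layoutFactors P A) = lowSum P := by
  have h1 := hA.sum_position
  rw [Finset.sum_add_distrib] at h1
  rw [areaL, lowSum_eq, Fin.sum_univ_succ, branchSum_zero_zero, zero_add]
  simp only [hA.layoutFactors_fst]
  linarith

/-- The right end exceeds the inorder position by one plus the total size of the larger branches.
The n ones add up to n, which is the contribution of the root to `highSum`. -/
theorem areaU_layoutFactors : areaU (layoutFactors P A) = highSum P := by
  have h1 := hA.sum_position
  have h2 : ∑ k : Fin n, (A k.succ + size P k.succ) =
      ∑ k : Fin n, (A k.succ + branchSum P k.succ 0 k.succ) + n +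
        ∑ k : Fin n, branchSum P k.succ (k.succ + 1) (n + 1) := by
    have : (n : ℤ) = ∑ k : Fin n, 1 := by simp
    rw [this, ← Finset.sum_add_distrib, ← Finset.sum_add_distrib]
    refine Finset.sum_congr rfl fun k _ => ?_
    rw [size_eq' hA.mem]
    ring
  have h3 := size_eq' hA.mem 0
  rw [size_zero hA.mem, branchSum_zero_zero] at h3
  rw [areaU, highSum_eq, Fin.sum_univ_succ]
  simp only [hA.layoutFactors_snd]
  linarith

theorem below_iff_interval {x y : Fin (n + 1)} :
    Below P x y ↔ A x ≤ A y ∧ A y + size P y ≤ A x + size P x := by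
  obtain ⟨h0, hb⟩ := mem_treeMaps.1 hA.mem
  refine ⟨hA.bounds_below, fun h => ?_⟩
  by_contra h1
  by_cases h2 : Below P y x
  · have hlt : (sub P x).card < (sub P y).card := by
      refine Finset.card_lt_card ⟨fun z hz => ?_, fun h3 => ?_⟩
      · rw [mem_sub] at hz ⊢
        exact h2.trans hz
      · exact h1 (mem_sub.1 (h3 (mem_sub.2 .refl)))
    have h3 := hA.bounds_below h2
    have h4 : size P x < size P y := by
      unfold size
      exact_mod_cast hlt
    linarith
  · have h3 := size_pos P x
    have h4 := size_pos P y
    rcases hA.disjoint_of_not_below h1 h2 with h5 | h5 <;> linarith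

end IsLayout

/-- The factors show the ends of all intervals except that of the root, and containment of intervals
is the ancestor relation. -/
theorem layoutFactors_inj {P P' : Fin (n + 1) → Fin (n + 1)} {A A' : Fin (n + 1) → ℤ}
    (hA : IsLayout P A) (hA' : IsLayout P' A') (h : layoutFactors P A = layoutFactors P' A') :
    P = P' := by
  obtain ⟨h0, hb⟩ := mem_treeMaps.1 hA.mem
  obtain ⟨h0', hb'⟩ := mem_treeMaps.1 hA'.mem
  have h1 : ∀ x, x ≠ 0 → A x = A' x := by
    intro x hx
    obtain ⟨k, rfl⟩ := Fin.exists_succ_eq.2 hx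
    rw [← hA.layoutFactors_fst, ← hA'.layoutFactors_fst, h]
  have h2 : ∀ x, x ≠ 0 → A x + size P x = A' x + size P' x := by
    intro x hx
    obtain ⟨k, rfl⟩ := Fin.exists_succ_eq.2 hx
    rw [← hA.layoutFactors_snd, ← hA'.layoutFactors_snd, h]
  refine eq_of_below_iff h0 h0' hb hb' fun x y => ?_
  by_cases hx : x = 0
  · rw [hx]
    exact iff_of_true (hb y) (hb' y)
  by_cases hy : y = 0
  · rw [hy]
    exact iff_of_false (fun h => hx (h.eq_of_fixed h0)) (fun h => hx (h.eq_of_fixed h0'))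
  rw [hA.below_iff_interval, hA'.below_iff_interval, h2 x hx, h2 y hy, h1 x hx, h1 y hy]

end Layout

/-! ### Dénes' double count -/

section EdgeSequences

open BounceRef

variable {n : ℕ}

theorem injective_of_edgeSet_eq_range {T : SimpleGraph (Fin (n + 1))} (hT : T.IsTree)
    {e : Fin n → Sym2 (Fin (n + 1))} (h : T.edgeSet = Set.range e) : Function.Injective e := by
  have h1 := (SimpleGraph.isTree_iff_connected_and_card.1 hT).2
  rw [h, Nat.card_fin, Nat.add_right_cancel_iff] at h1
  have h2 : Function.Bijective (Set.rangeFactorization e) :=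
    Set.rangeFactorization_surjective.bijective_of_nat_card_le (by rw [h1, Nat.card_fin])
  intro i j hij
  exact h2.1 (Subtype.ext hij)

open Classical in
/-- The orderings of the edges of trees. -/
noncomputable def treeOrderings (n : ℕ) : Finset (Fin n → Sym2 (Fin (n + 1))) :=
  Finset.univ.filter fun e => (∀ k, ¬ (e k).IsDiag) ∧
    (SimpleGraph.fromEdgeSet (Set.range e)).IsTree

theorem edgeSet_fromEdgeSet_range {e : Fin n → Sym2 (Fin (n + 1))} (he : ∀ k, ¬ (e k).IsDiag) :
    (SimpleGraph.fromEdgeSet (Set.range e)).edgeSet = Set.range e := by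
  rw [SimpleGraph.edgeSet_fromEdgeSet, sdiff_eq_left, Set.disjoint_left]
  rintro _ ⟨k, rfl⟩ h
  exact he k h

/-- A tree has n edges, so a sequence of length n that exhausts them has no repetition, and any two
such sequences differ by a permutation of the indices. -/
theorem card_treeOrderings_le : (treeOrderings n).card ≤ n.factorial * (trees n).card := by
  classical
  refine Finset.card_le_mul_card_image_of_maps_to
    (f := fun e => SimpleGraph.fromEdgeSet (Set.range e)) ?_ _ ?_
  · intro e he
    rw [treeOrderings, Finset.mem_filter] at he
    exact mem_trees.2 he.2.2
  · intro T hT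
    rw [mem_trees] at hT
    have edges : ∀ e ∈ (treeOrderings n).filter
        (fun e => SimpleGraph.fromEdgeSet (Set.range e) = T), T.edgeSet = Set.range e := by
      intro e he
      rw [Finset.mem_filter, treeOrderings, Finset.mem_filter] at he
      rw [← he.2, edgeSet_fromEdgeSet_range he.1.2.1]
    rcases Finset.eq_empty_or_nonempty ((treeOrderings n).filter
        (fun e => SimpleGraph.fromEdgeSet (Set.range e) = T)) with h | ⟨e₀, h₀⟩
    · rw [h, Finset.card_empty]
      exact Nat.zero_le _
    · have hsub : (treeOrderings n).filter (fun e => SimpleGraph.fromEdgeSet (Set.range e) = T) ⊆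
          (Finset.univ : Finset (Equiv.Perm (Fin n))).image (fun π : Equiv.Perm (Fin n) => e₀ ∘ (π : Fin n → Fin n)) := by
        intro e he
        have h1 := edges e he
        have hinj := injective_of_edgeSet_eq_range hT h1
        have h2 : ∀ k, ∃ j, e₀ j = e k := by
          intro k
          have : e k ∈ Set.range e₀ := by
            rw [← edges e₀ h₀, h1]
            exact ⟨k, rfl⟩
          exact this
        choose π hπ using h2
        have hπinj : Function.Injective π := fun i j hij => hinj (by rw [← hπ, ← hπ, hij])
        rw [Finset.mem_image]
        exact ⟨Equiv.ofBijective π (Finite.injective_iff_bijective.1 hπinj), Finset.mem_univ _,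
          funext hπ⟩
      calc _ ≤ _ := Finset.card_le_card hsub
        _ ≤ _ := Finset.card_image_le
        _ = n.factorial := by rw [Finset.card_univ, Fintype.card_perm, Fintype.card_fin]

/-- The edges of a conjugate of a sequence of transpositions. -/
def conjEdges (g : Equiv.Perm (Fin (n + 1))) (f : Fin n → Fin (n + 1) × Fin (n + 1)) :
    Fin n → Sym2 (Fin (n + 1)) := fun k => s(g (f k).1, g (f k).2)

/-- The transposition of the ends of an edge. -/
def edgeSwap : Sym2 (Fin (n + 1)) → Equiv.Perm (Fin (n + 1)) :=
  Sym2.lift ⟨Equiv.swap, Equiv.swap_comm⟩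

theorem prod_edgeSwap (g : Equiv.Perm (Fin (n + 1))) (f : Fin n → Fin (n + 1) × Fin (n + 1)) :
    (List.ofFn fun k => edgeSwap (conjEdges g f k)).reverse.prod =
      g * leftToRightProd f * g⁻¹ := by
  rw [leftToRightProd, ← MulAut.conj_apply, map_list_prod, List.map_reverse, List.map_ofFn]
  congr 3
  funext k
  exact Equiv.swap_apply_apply g _ _

theorem eq_one_of_commute_finRotate {g : Equiv.Perm (Fin (n + 1))} (h0 : g 0 = 0)
    (h : g * finRotate (n + 1) = finRotate (n + 1) * g) : g = 1 := by
  ext i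
  rw [Equiv.Perm.one_apply]
  congr 1
  induction i using Fin.induction with
  | zero => exact h0
  | succ i ih =>
    have h1 := Equiv.congr_fun h i.castSucc
    rw [Equiv.Perm.mul_apply, Equiv.Perm.mul_apply, ih, finRotate_apply,
      Fin.coeSucc_eq_succ] at h1
    exact h1

/-- The product of the edge transpositions is the conjugate of the cycle by `g`. It determines `g`,
because only the identity fixes 0 and commutes with the cycle. Within each factor the condition a <
b then fixes the order of the two ends. -/
theorem conjEdges_inj {g g' : Equiv.Perm (Fin (n + 1))} (hg : g 0 = 0) (hg' : g' 0 = 0)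
    {f f' : Fin n → Fin (n + 1) × Fin (n + 1)} (hf : f ∈ factorizations n)
    (hf' : f' ∈ factorizations n) (h : conjEdges g f = conjEdges g' f') : g = g' ∧ f = f' := by
  rw [factorizations, Finset.mem_filter] at hf hf'
  have h1 : g = g' := by
    have h2 := prod_edgeSwap g f
    rw [h, prod_edgeSwap, hf.2.2, hf'.2.2] at h2
    have h3 : g'⁻¹ * g = 1 := by
      refine eq_one_of_commute_finRotate ?_ ?_
      · rw [Equiv.Perm.mul_apply, hg, Equiv.Perm.inv_eq_iff_eq, hg']
      · rw [mul_inv_eq_iff_eq_mul] at h2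
        rw [mul_assoc, inv_mul_eq_iff_eq_mul, ← mul_assoc, ← mul_assoc, h2]
        group
    exact (inv_mul_eq_one.1 h3).symm
  refine ⟨h1, ?_⟩
  subst h1
  funext k
  have h2 := congrFun h k
  rw [conjEdges, conjEdges, Sym2.eq_iff] at h2
  have h3 := hf.2.1 k
  have h4 := hf'.2.1 k
  rcases h2 with h2 | h2
  · exact Prod.ext (g.injective h2.1) (g.injective h2.2)
  · rw [g.injective h2.1, g.injective h2.2] at h3
    exact absurd h3 h4.not_gt

open Classical in
-- Each transposition moves a point along an edge, so a point stays in its component under the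
-- product. The product is a full cycle, so the graph is connected; having at most n edges, it is a
-- tree.
theorem conjEdges_mem (g : Equiv.Perm (Fin (n + 1))) {f : Fin n → Fin (n + 1) × Fin (n + 1)}
    (hf : f ∈ factorizations n) : conjEdges g f ∈ treeOrderings n := by
  rw [factorizations, Finset.mem_filter] at hf
  have hdiag : ∀ k, ¬ (conjEdges g f k).IsDiag := fun k h =>
    (hf.2.1 k).ne (g.injective (Sym2.mk_isDiag_iff.1 h))
  rw [treeOrderings, Finset.mem_filter]
  refine ⟨Finset.mem_univ _, hdiag, ?_⟩
  set G := SimpleGraph.fromEdgeSet (Set.range (conjEdges g f)) with hG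
  have hadj : ∀ k, G.Adj (g (f k).1) (g (f k).2) := by
    intro k
    rw [hG, SimpleGraph.fromEdgeSet_adj]
    exact ⟨⟨k, rfl⟩, fun h => (hf.2.1 k).ne (g.injective h)⟩
  have hreach := reverse_prod_ofFn_induction (fun k => edgeSwap (conjEdges g f k))
    (fun _ Q => ∀ x, G.Reachable x (Q x)) (fun x => .refl x) (by
      intro k Q hQ x
      refine (hQ x).trans ?_
      rw [Equiv.Perm.mul_apply]
      change G.Reachable (Q x) (Equiv.swap (g (f k).1) (g (f k).2) (Q x))
      rw [Equiv.swap_apply_def]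
      split_ifs with h1 h2
      · rw [h1]; exact (hadj k).reachable
      · rw [h2]; exact (hadj k).symm.reachable
      · exact .refl _)
  rw [prod_edgeSwap, hf.2.2] at hreach
  have h0 : ∀ i, G.Reachable (g 0) (g i) := by
    intro i
    induction i using Fin.induction with
    | zero => exact .refl _
    | succ i ih =>
      have h1 := hreach (g i.castSucc)
      rw [Equiv.Perm.mul_apply, Equiv.Perm.mul_apply, Equiv.Perm.inv_def, Equiv.symm_apply_apply,
        finRotate_apply, Fin.coeSucc_eq_succ] at h1
      exact ih.trans h1
  have h1 : ∀ x, G.Reachable (g 0) x := by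
    intro x
    have := h0 (g.symm x)
    rwa [Equiv.apply_symm_apply] at this
  refine isTree_of_edgeSet_subset ?_ (conjEdges g f) (edgeSet_fromEdgeSet_range hdiag).subset
  exact (SimpleGraph.connected_iff _).2 ⟨fun x y => (h1 x).symm.trans (h1 y), ⟨0⟩⟩

/-- Dénes' double count: there are at most as many minimal factorizations as trees. -/
theorem card_factorizations_le : (factorizations n).card ≤ (trees n).card := by
  classical
  have h1 : (factorizations n ×ˢ (Finset.univ : Finset (Equiv.Perm (Fin n)))).card ≤
      (treeOrderings n).card := by
    -- `decomposeFin.symm (0, π)` runs through the n! permutations of [n] that fix 0.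
    refine Finset.card_le_card_of_injOn
      (fun x => conjEdges (Equiv.Perm.decomposeFin.symm (0, x.2)) x.1) ?_ ?_
    · rintro ⟨f, π⟩ h
      exact conjEdges_mem _ (Finset.mem_product.1 h).1
    · rintro ⟨f, π⟩ h ⟨f', π'⟩ h' he
      obtain ⟨h2, rfl⟩ := conjEdges_inj (Equiv.Perm.decomposeFin_symm_apply_zero _ _)
        (Equiv.Perm.decomposeFin_symm_apply_zero _ _) (Finset.mem_product.1 h).1
        (Finset.mem_product.1 h').1 he
      have h3 := Equiv.Perm.decomposeFin.symm.injective h2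
      rw [Prod.mk.injEq] at h3
      exact Prod.ext rfl h3.2
  rw [Finset.card_product, Finset.card_univ, Fintype.card_perm, Fintype.card_fin] at h1
  have h2 := h1.trans card_treeOrderings_le
  rw [mul_comm] at h2
  exact Nat.le_of_mul_le_mul_left h2 (Nat.factorial_pos n)

end EdgeSequences

/-! ### Bijectivity of the layout map and the enumerator of factorizations -/

section Enumerators

open BounceRef

variable {n : ℕ}

theorem exists_layouts (n : ℕ) : ∃ A : (Fin (n + 1) → Fin (n + 1)) → Fin (n + 1) → ℤ,
    ∀ P ∈ treeMaps n, IsLayout P (A P) := by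
  classical
  choose A hA using fun P (hP : P ∈ treeMaps n) => exists_layout hP
  exact ⟨fun P => if hP : P ∈ treeMaps n then A P hP else 0, fun P hP => by
    simpa only [dif_pos hP] using hA P hP⟩

/-- Every minimal factorization comes from the layout of a tree. -/
theorem exists_layoutFactors_eq {A : (Fin (n + 1) → Fin (n + 1)) → Fin (n + 1) → ℤ}
    (hA : ∀ P ∈ treeMaps n, IsLayout P (A P)) {f : Fin n → Fin (n + 1) × Fin (n + 1)}
    (hf : f ∈ factorizations n) : ∃ P ∈ treeMaps n, layoutFactors P (A P) = f := by
  obtain ⟨P, hP, h⟩ := Finset.surj_on_of_inj_on_of_card_le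
    (s := treeMaps n) (t := factorizations n) (fun P _ => layoutFactors P (A P))
    (fun P hP => (hA P hP).layoutFactors_mem)
    (fun P P' hP hP' h => layoutFactors_inj (hA P hP) (hA P' hP') h)
    (by rw [← card_trees]; exact card_factorizations_le) f hf
  exact ⟨P, hP, h.symm⟩

theorem area_nonneg {f : Fin n → Fin (n + 1) × Fin (n + 1)} (hf : f ∈ factorizations n) :
    0 ≤ areaL f ∧ 0 ≤ areaU f := by
  obtain ⟨A, hA⟩ := exists_layouts n
  obtain ⟨P, hP, rfl⟩ := exists_layoutFactors_eq hA hf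
  rw [(hA P hP).areaL_layoutFactors, (hA P hP).areaU_layoutFactors]
  exact ⟨Int.natCast_nonneg _, Int.natCast_nonneg _⟩

theorem factPoly_eq : factPoly n = weightSum (rootWeight q t) Finset.univ (0 : Fin (n + 1)) := by
  obtain ⟨A, hA⟩ := exists_layouts n
  rw [factPoly, weightSum]
  symm
  refine Finset.sum_bij (fun P _ => layoutFactors P (A P)) ?_ ?_ ?_ ?_
  · exact fun P hP => (hA P hP).layoutFactors_mem
  · exact fun P hP P' hP' h => layoutFactors_inj (hA P hP) (hA P' hP') h
  · intro f hf
    obtain ⟨P, hP, h⟩ := exists_layoutFactors_eq hA hf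
    exact ⟨P, hP, h⟩
  · intro P hP
    rw [(hA P hP).areaL_layoutFactors, (hA P hP).areaU_layoutFactors, Int.toNat_natCast,
      Int.toNat_natCast]
    exact weight_rootWeight q t hP

end Enumerators

end ParentTree

/-- The first conjunct says that the exponents in `F_n(q, t)` are nonnegative, so that the
truncation `Int.toNat` in its definition changes nothing. -/
theorem theorem7p1 (n : ℕ) :
    (∀ f ∈ BounceRef.factorizations n, 0 ≤ BounceRef.areaL f ∧ 0 ≤ BounceRef.areaU f) ∧
      BounceRef.treePoly n = BounceRef.factPoly n ∧
      BounceRef.factPoly n = BounceRef.parkPoly n := by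
  have h : BounceRef.treePoly n = BounceRef.factPoly n := by
    rw [ParentTree.treePoly_eq, ParentTree.factPoly_eq,
      ParentTree.weightSum_vertexWeight_eq_rootWeight _ _ _ _ (Finset.mem_univ _)]
  refine ⟨fun f hf => ParentTree.area_nonneg hf, h, ?_⟩
  rw [← h, ParentTree.treePoly_eq, ParentTree.parkPoly_eq]
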